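/- An RCC model $\langle A,C\rangle$ is a Boolean algebra $A$ with more than two elements together with a symmetric and reflexive binary relation $C$ on $A\setminus\{0\}$ such that (i) $C(x,x')$ for all $x\in A\setminus\{0,1\}$; (ii) for all $x,y,z\in A\setminus\{0\}$, $C(x,y\vee z)$ iff $C(x,y)$ or $C(x,z)$; (iii) for every $x\in A\setminus\{0,1\}$ there is $w\in A\setminus\{0,1\}$ such that $C(x,w)$ fails. Restrict $C$ to $U=A\setminus\{0,1\}$ and write $-$, $^{\sim}$, $\circ$ for complement, converse and composition of binary relations on $U$, where $R\circ S=\{(x,y):\exists z\in U,\ (x,z)\in R,\ (z,y)\in S\}$. Put $DC=-C$, $P=-(C\circ -C)$, $1'=P\cap P^{\sim}$, $PP=P\setminus 1'$, $O=P^{\sim}\circ P$, $EC=C\cap -O$, $TPP=PP\cap(EC\circ EC)$, $NTPP=PP\cap -TPP$, $\sharp=-(P\cup P^{\sim})$, $\mathsf{T}=-(P\circ P^{\sim})$, $PON=O\cap\sharp\cap-\mathsf{T}$, $POD=O\cap\sharp\cap\mathsf{T}$, $ECD=-O\cap\mathsf{T}$, $ECN=EC\cap-ECD$, $PODZ=ECD\circ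 NTPP$, $PODY=POD\setminus PODZ$. The RCC11 relations are $1'$, $TPP$, $TPP^{\sim}$, $NTPP$, $NTPP^{\sim}$, $PON$, $PODY$, $PODZ$, $ECN$, $ECD$, $DC$. The model is strong if whenever $x\,NTPP\,y$ there is $z\in U$ with $x\,NTPP\,z$ and $z\,NTPP\,y$. The following table lists, for RCC11 relations $R$ (row) and $S$ (column), the entries of the cell $\langle R,S\rangle$, some of them marked with a superscript $\times$. Here $T,N,PN,PY,PZ$ abbreviate $TPP,NTPP,PON,PODY,PODZ$; within each row the cells are listed as "column: entries". The cells $\langle 1',R\rangle$ and $\langle R,1'\rangle$ have the single unmarked entry $R$. - Row $T$: $T$: $T,\,N$; $T^{\sim}$: $1',\,T,\,T^{\sim},\,PN^{\times},\,ECN^{\times},\,DC$; $N$: $N$; $N^{\sim}$: $(T^{\sim})^{\times},\,N^{\sim},\,PN^{\times},\,ECN^{\times},\,DC$; $PN$: $T,\,N,\,PN,\,ECN,\,DC$; $PY$: $T^{\times},\,N,\,PN^{\times},\,PY,\,ECN,\,ECD$; $PZ$: $T^{\times},\,N,\,PN^{\times},\,PY^{\times},\,PZ$; $ECN$: $ECN,\,DC$;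 $ECD$: $ECN$; $DC$: $DC$. - Row $T^{\sim}$: $T$: $1',\,T,\,T^{\sim},\,PN^{\times},\,PY^{\times},\,PZ$; $T^{\sim}$: $T^{\sim},\,N^{\sim}$; $N$: $T^{\times},\,N,\,PN^{\times},\,PY^{\times},\,PZ$; $N^{\sim}$: $N^{\sim}$; $PN$: $T^{\sim},\,N^{\sim},\,PN,\,PY,\,PZ$; $PY$: $PY,\,PZ$; $PZ$: $PZ$; $ECN$: $(T^{\sim})^{\times},\,N^{\sim},\,PN^{\times},\,PY,\,ECN,\,ECD$; $ECD$: $PY$; $DC$: $(T^{\sim})^{\times},\,N^{\sim},\,PN^{\times},\,ECN^{\times},\,DC$. - Row $N$: $T$: $N$; $T^{\sim}$: $T^{\times},\,N,\,PN^{\times},\,ECN^{\times},\,DC$; $N$: $N$; $N^{\sim}$: $1',\,T,\,T^{\sim},\,N,\,N^{\sim},\,PN,\,ECN,\,DC$; $PN$: $T,\,N,\,PN,\,ECN,\,DC$; $PY$: $T^{\times},\,N,\,PN^{\times},\,ECN^{\times},\,DC$; $PZ$: $T,\,N,\,PN,\,PY,\,PZ,\,ECN,\,ECD,\,DC$; $ECN$: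 $DC$; $ECD$: $DC$; $DC$: $DC$. - Row $N^{\sim}$: $T$: $(T^{\sim})^{\times},\,N^{\sim},\,PN^{\times},\,PY^{\times},\,PZ$; $T^{\sim}$: $N^{\sim}$; $N$: $1',\,T,\,T^{\sim},\,N,\,N^{\sim},\,PN,\,PY,\,PZ$; $N^{\sim}$: $N^{\sim}$; $PN$: $T^{\sim},\,N^{\sim},\,PN,\,PY,\,PZ$; $PY$: $PZ$; $PZ$: $PZ$; $ECN$: $(T^{\sim})^{\times},\,N^{\sim},\,PN^{\times},\,PY^{\times},\,PZ$; $ECD$: $PZ$; $DC$: $T^{\sim},\,N^{\sim},\,PN,\,PY,\,PZ,\,ECN,\,ECD,\,DC$. - Row $PN$: $T$: $T,\,N,\,PN,\,PY,\,PZ$; $T^{\sim}$: $T^{\sim},\,N^{\sim},\,PN,\,ECN,\,DC$; $N$: $T,\,N,\,PN,\,PY,\,PZ$; $N^{\sim}$: $T^{\sim},\,N^{\sim},\,PN,\,ECN,\,DC$; $PN$: $1',\,T,\,T^{\sim},\,N,\,N^{\sim},\,PN,\,PY,\,PZ,\,ECN,\,ECD,\,DC$; $PY$: $T,\,N,\,PN,\,PY,\,PZ$;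 $PZ$: $T,\,N,\,PN,\,PY,\,PZ$; $ECN$: $T^{\sim},\,N^{\sim},\,PN,\,ECN,\,DC$; $ECD$: $PN$; $DC$: $T^{\sim},\,N^{\sim},\,PN,\,ECN,\,DC$. - Row $PY$: $T$: $PY,\,PZ$; $T^{\sim}$: $(T^{\sim})^{\times},\,N^{\sim},\,PN^{\times},\,PY,\,ECN,\,ECD$; $N$: $PZ$; $N^{\sim}$: $(T^{\sim})^{\times},\,N^{\sim},\,PN^{\times},\,ECN^{\times},\,DC$; $PN$: $T^{\sim},\,N^{\sim},\,PN,\,PY,\,PZ$; $PY$: $1',\,T,\,T^{\sim},\,PN^{\times},\,PY^{\times},\,PZ$; $PZ$: $T^{\times},\,N,\,PN^{\times},\,PY^{\times},\,PZ$; $ECN$: $T^{\sim},\,N^{\sim}$; $ECD$: $T^{\sim}$; $DC$: $N^{\sim}$. - Row $PZ$: $T$: $PZ$; $T^{\sim}$: $(T^{\sim})^{\times},\,N^{\sim},\,PN^{\times},\,PY^{\times},\,PZ$; $N$: $PZ$; $N^{\sim}$: $T^{\sim},\,N^{\sim},\,PN,\,PY,\,PZ,\,ECN,\,ECD,\,DC$;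 $PN$: $T^{\sim},\,N^{\sim},\,PN,\,PY,\,PZ$; $PY$: $(T^{\sim})^{\times},\,N^{\sim},\,PN^{\times},\,PY^{\times},\,PZ$; $PZ$: $1',\,T,\,T^{\sim},\,N,\,N^{\sim},\,PN,\,PY,\,PZ$; $ECN$: $N^{\sim}$; $ECD$: $N^{\sim}$; $DC$: $N^{\sim}$. - Row $ECN$: $T$: $T^{\times},\,N,\,PN^{\times},\,PY,\,ECN,\,ECD$; $T^{\sim}$: $ECN,\,DC$; $N$: $T^{\times},\,N,\,PN^{\times},\,PY^{\times},\,PZ$; $N^{\sim}$: $DC$; $PN$: $T,\,N,\,PN,\,ECN,\,DC$; $PY$: $T,\,N$; $PZ$: $N$; $ECN$: $1',\,T,\,T^{\sim},\,PN^{\times},\,ECN^{\times},\,DC$; $ECD$: $T$; $DC$: $(T^{\sim})^{\times},\,N^{\sim},\,PN^{\times},\,ECN^{\times},\,DC$. - Row $ECD$: $T$: $PY$; $T^{\sim}$: $ECN$; $N$: $PZ$; $N^{\sim}$: $DC$; $PN$: $PN$; $PY$: $T$; $PZ$: $N$; $ECN$: $T^{\sim}$; $ECD$: $1'$; $DC$: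 $N^{\sim}$. - Row $DC$: $T$: $T^{\times},\,N,\,PN^{\times},\,ECN^{\times},\,DC$; $T^{\sim}$: $DC$; $N$: $T,\,N,\,PN,\,PY,\,PZ,\,ECN,\,ECD,\,DC$; $N^{\sim}$: $DC$; $PN$: $T,\,N,\,PN,\,ECN,\,DC$; $PY$: $N$; $PZ$: $N$; $ECN$: $T^{\times},\,N,\,PN^{\times},\,ECN^{\times},\,DC$; $ECD$: $N$; $DC$: $1',\,T,\,T^{\sim},\,N,\,N^{\sim},\,PN,\,ECN,\,DC$. Theorem. For every strong RCC model and all RCC11 relations $R,Q,S$: 1. $Q\cap(R\circ S)\neq\emptyset$ if and only if $Q$ is an entry (marked or not) of the cell $\langle R,S\rangle$; 2. $Q\subseteq R\circ S$ if and only if $Q$ is an entry of the cell $\langle R,S\rangle$ without the mark $\times$. In particular a marked entry satisfies $Q\nsubseteq R\circ S$ in every strong RCC model. Moreover, $Q\subseteq R\circ S$ holds in all strong RCC models if and only if $Q$ is an unmarked entry of the cell $\langle R,S\rangle$. For example $\langle TPP^{\sim},PODY,TPP\rangle$ is not extensional, while $\langle TPP^{\sim},PODZ,TPP\rangle$ is.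 -/

import Mathlib

open scoped SetRel

universe u

/-- A model of the Region Connection Calculus, as a Boolean connection algebra: a Boolean algebra
`A` with more than two elements and a contact relation `C` on `A \ {0}`. -/
structure RCCModel (A : Type u) [BooleanAlgebra A] where
  /-- The contact relation, a set of pairs of nonzero elements (see `ne_bot`). -/
  C : SetRel A A
  /-- `A` has more than two elements. -/
  exists_ne : ∃ x : A, x ≠ ⊥ ∧ x ≠ ⊤
  ne_bot : ∀ x y : A, (x, y) ∈ C → x ≠ ⊥ ∧ y ≠ ⊥
  refl : ∀ x : A, x ≠ ⊥ → (x, x) ∈ C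
  symm : ∀ x y : A, (x, y) ∈ C → (y, x) ∈ C
  compl : ∀ x : A, x ≠ ⊥ → x ≠ ⊤ → (x, xᶜ) ∈ C
  sup : ∀ x y z : A, x ≠ ⊥ → y ≠ ⊥ → z ≠ ⊥ → ((x, y ⊔ z) ∈ C ↔ (x, y) ∈ C ∨ (x, z) ∈ C)
  exists_not : ∀ x : A, x ≠ ⊥ → x ≠ ⊤ → ∃ w : A, w ≠ ⊥ ∧ w ≠ ⊤ ∧ (x, w) ∉ C

/-- The domain `U = A \ {0, 1}` of regions on which all relations below live. -/
abbrev Region (A : Type u) [BooleanAlgebra A] : Type u := {x : A // x ≠ ⊥ ∧ x ≠ ⊤}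

namespace RCCModel

variable {A : Type u} [BooleanAlgebra A] (M : RCCModel A)

/-! The relations on `U` generated by the contact relation. Complements, compositions `○`
and converses `inv` are taken on `U`; in `R ○ S` the relation `R` comes first. -/

/-- Contact restricted to `U`. -/
def Con : SetRel (Region A) (Region A) := {p | (p.1.1, p.2.1) ∈ M.C}

/-- Disconnected. -/
def DC : SetRel (Region A) (Region A) := M.Conᶜ

/-- Part of. -/
def P : SetRel (Region A) (Region A) := (M.Con ○ M.Conᶜ)ᶜ

/-- The identity relation `1'`. -/
def One : SetRel (Region A) (Region A) := M.P ∩ M.P.inv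

/-- Proper part. -/
def PP : SetRel (Region A) (Region A) := M.P \ M.One

/-- Overlap. -/
def O : SetRel (Region A) (Region A) := M.P.inv ○ M.P

/-- Externally connected. -/
def EC : SetRel (Region A) (Region A) := M.Con ∩ M.Oᶜ

/-- Tangential proper part. -/
def TPP : SetRel (Region A) (Region A) := M.PP ∩ (M.EC ○ M.EC)

/-- Non-tangential proper part. -/
def NTPP : SetRel (Region A) (Region A) := M.PP ∩ M.TPPᶜ

/-- Incomparability, written `♯`. -/
def Incomp : SetRel (Region A) (Region A) := (M.P ∪ M.P.inv)ᶜ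

/-- The relation `T = -(P ∘ P~)`: no region contains both arguments. -/
def T : SetRel (Region A) (Region A) := (M.P ○ M.P.inv)ᶜ

def PON : SetRel (Region A) (Region A) := M.O ∩ M.Incomp ∩ M.Tᶜ

def POD : SetRel (Region A) (Region A) := M.O ∩ M.Incomp ∩ M.T

def ECD : SetRel (Region A) (Region A) := M.Oᶜ ∩ M.T

def ECN : SetRel (Region A) (Region A) := M.EC ∩ M.ECDᶜ

def PODZ : SetRel (Region A) (Region A) := M.ECD ○ M.NTPP

def PODY : SetRel (Region A) (Region A) := M.POD \ M.PODZ

/-- A strong model: `NTPP` has the interpolation property. -/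
def IsStrong : Prop :=
  ∀ x y : Region A, (x, y) ∈ M.NTPP → ∃ z : Region A, (x, z) ∈ M.NTPP ∧ (z, y) ∈ M.NTPP

end RCCModel

/-- The eleven RCC11 relation symbols; `one` is `1'`, and `TPPi`, `NTPPi` are the converses
of `TPP`, `NTPP`. -/
inductive RCC11 : Type
  | one | TPP | TPPi | NTPP | NTPPi | PON | PODY | PODZ | ECN | ECD | DC

/-- The interpretation of the relation symbols in a model. -/
def RCCModel.rel {A : Type u} [BooleanAlgebra A] (M : RCCModel A) :
    RCC11 → SetRel (Region A) (Region A)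
  | .one => M.One
  | .TPP => M.TPP
  | .TPPi => M.TPP.inv
  | .NTPP => M.NTPP
  | .NTPPi => M.NTPP.inv
  | .PON => M.PON
  | .PODY => M.PODY
  | .PODZ => M.PODZ
  | .ECN => M.ECN
  | .ECD => M.ECD
  | .DC => M.DC

namespace RCC11

/-- A cell of the composition table: the entries without and with a superscript `×`. -/
structure Cell : Type where
  plain : List RCC11
  crossed : List RCC11

/-- The marked RCC11 composition table; `table R S` is the cell specified by `R` (row) and
`S` (column). The row and the column of `1'` are the obvious ones. -/
def table : RCC11 → RCC11 → Cell
  | one, S => ⟨[S], []⟩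
  | R, one => ⟨[R], []⟩
  | TPP, TPP => ⟨[TPP, NTPP], []⟩
  | TPP, TPPi => ⟨[one, TPP, TPPi, DC], [PON, ECN]⟩
  | TPP, NTPP => ⟨[NTPP], []⟩
  | TPP, NTPPi => ⟨[NTPPi, DC], [TPPi, PON, ECN]⟩
  | TPP, PON => ⟨[TPP, NTPP, PON, ECN, DC], []⟩
  | TPP, PODY => ⟨[NTPP, PODY, ECN, ECD], [TPP, PON]⟩
  | TPP, PODZ => ⟨[NTPP, PODZ], [TPP, PON, PODY]⟩
  | TPP, ECN => ⟨[ECN, DC], []⟩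
  | TPP, ECD => ⟨[ECN], []⟩
  | TPP, DC => ⟨[DC], []⟩
  | TPPi, TPP => ⟨[one, TPP, TPPi, PODZ], [PON, PODY]⟩
  | TPPi, TPPi => ⟨[TPPi, NTPPi], []⟩
  | TPPi, NTPP => ⟨[NTPP, PODZ], [TPP, PON, PODY]⟩
  | TPPi, NTPPi => ⟨[NTPPi], []⟩
  | TPPi, PON => ⟨[TPPi, NTPPi, PON, PODY, PODZ], []⟩
  | TPPi, PODY => ⟨[PODY, PODZ], []⟩
  | TPPi, PODZ => ⟨[PODZ], []⟩
  | TPPi, ECN => ⟨[NTPPi, PODY, ECN, ECD], [TPPi, PON]⟩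
  | TPPi, ECD => ⟨[PODY], []⟩
  | TPPi, DC => ⟨[NTPPi, DC], [TPPi, PON, ECN]⟩
  | NTPP, TPP => ⟨[NTPP], []⟩
  | NTPP, TPPi => ⟨[NTPP, DC], [TPP, PON, ECN]⟩
  | NTPP, NTPP => ⟨[NTPP], []⟩
  | NTPP, NTPPi => ⟨[one, TPP, TPPi, NTPP, NTPPi, PON, ECN, DC], []⟩
  | NTPP, PON => ⟨[TPP, NTPP, PON, ECN, DC], []⟩
  | NTPP, PODY => ⟨[NTPP, DC], [TPP, PON, ECN]⟩
  | NTPP, PODZ => ⟨[TPP, NTPP, PON, PODY, PODZ, ECN, ECD, DC], []⟩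
  | NTPP, ECN => ⟨[DC], []⟩
  | NTPP, ECD => ⟨[DC], []⟩
  | NTPP, DC => ⟨[DC], []⟩
  | NTPPi, TPP => ⟨[NTPPi, PODZ], [TPPi, PON, PODY]⟩
  | NTPPi, TPPi => ⟨[NTPPi], []⟩
  | NTPPi, NTPP => ⟨[one, TPP, TPPi, NTPP, NTPPi, PON, PODY, PODZ], []⟩
  | NTPPi, NTPPi => ⟨[NTPPi], []⟩
  | NTPPi, PON => ⟨[TPPi, NTPPi, PON, PODY, PODZ], []⟩
  | NTPPi, PODY => ⟨[PODZ], []⟩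
  | NTPPi, PODZ => ⟨[PODZ], []⟩
  | NTPPi, ECN => ⟨[NTPPi, PODZ], [TPPi, PON, PODY]⟩
  | NTPPi, ECD => ⟨[PODZ], []⟩
  | NTPPi, DC => ⟨[TPPi, NTPPi, PON, PODY, PODZ, ECN, ECD, DC], []⟩
  | PON, TPP => ⟨[TPP, NTPP, PON, PODY, PODZ], []⟩
  | PON, TPPi => ⟨[TPPi, NTPPi, PON, ECN, DC], []⟩
  | PON, NTPP => ⟨[TPP, NTPP, PON, PODY, PODZ], []⟩
  | PON, NTPPi => ⟨[TPPi, NTPPi, PON, ECN, DC], []⟩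
  | PON, PON => ⟨[one, TPP, TPPi, NTPP, NTPPi, PON, PODY, PODZ, ECN, ECD, DC], []⟩
  | PON, PODY => ⟨[TPP, NTPP, PON, PODY, PODZ], []⟩
  | PON, PODZ => ⟨[TPP, NTPP, PON, PODY, PODZ], []⟩
  | PON, ECN => ⟨[TPPi, NTPPi, PON, ECN, DC], []⟩
  | PON, ECD => ⟨[PON], []⟩
  | PON, DC => ⟨[TPPi, NTPPi, PON, ECN, DC], []⟩
  | PODY, TPP => ⟨[PODY, PODZ], []⟩
  | PODY, TPPi => ⟨[NTPPi, PODY, ECN, ECD], [TPPi, PON]⟩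
  | PODY, NTPP => ⟨[PODZ], []⟩
  | PODY, NTPPi => ⟨[NTPPi, DC], [TPPi, PON, ECN]⟩
  | PODY, PON => ⟨[TPPi, NTPPi, PON, PODY, PODZ], []⟩
  | PODY, PODY => ⟨[one, TPP, TPPi, PODZ], [PON, PODY]⟩
  | PODY, PODZ => ⟨[NTPP, PODZ], [TPP, PON, PODY]⟩
  | PODY, ECN => ⟨[TPPi, NTPPi], []⟩
  | PODY, ECD => ⟨[TPPi], []⟩
  | PODY, DC => ⟨[NTPPi], []⟩
  | PODZ, TPP => ⟨[PODZ], []⟩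
  | PODZ, TPPi => ⟨[NTPPi, PODZ], [TPPi, PON, PODY]⟩
  | PODZ, NTPP => ⟨[PODZ], []⟩
  | PODZ, NTPPi => ⟨[TPPi, NTPPi, PON, PODY, PODZ, ECN, ECD, DC], []⟩
  | PODZ, PON => ⟨[TPPi, NTPPi, PON, PODY, PODZ], []⟩
  | PODZ, PODY => ⟨[NTPPi, PODZ], [TPPi, PON, PODY]⟩
  | PODZ, PODZ => ⟨[one, TPP, TPPi, NTPP, NTPPi, PON, PODY, PODZ], []⟩
  | PODZ, ECN => ⟨[NTPPi], []⟩
  | PODZ, ECD => ⟨[NTPPi], []⟩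
  | PODZ, DC => ⟨[NTPPi], []⟩
  | ECN, TPP => ⟨[NTPP, PODY, ECN, ECD], [TPP, PON]⟩
  | ECN, TPPi => ⟨[ECN, DC], []⟩
  | ECN, NTPP => ⟨[NTPP, PODZ], [TPP, PON, PODY]⟩
  | ECN, NTPPi => ⟨[DC], []⟩
  | ECN, PON => ⟨[TPP, NTPP, PON, ECN, DC], []⟩
  | ECN, PODY => ⟨[TPP, NTPP], []⟩
  | ECN, PODZ => ⟨[NTPP], []⟩
  | ECN, ECN => ⟨[one, TPP, TPPi, DC], [PON, ECN]⟩
  | ECN, ECD => ⟨[TPP], []⟩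
  | ECN, DC => ⟨[NTPPi, DC], [TPPi, PON, ECN]⟩
  | ECD, TPP => ⟨[PODY], []⟩
  | ECD, TPPi => ⟨[ECN], []⟩
  | ECD, NTPP => ⟨[PODZ], []⟩
  | ECD, NTPPi => ⟨[DC], []⟩
  | ECD, PON => ⟨[PON], []⟩
  | ECD, PODY => ⟨[TPP], []⟩
  | ECD, PODZ => ⟨[NTPP], []⟩
  | ECD, ECN => ⟨[TPPi], []⟩
  | ECD, ECD => ⟨[one], []⟩
  | ECD, DC => ⟨[NTPPi], []⟩
  | DC, TPP => ⟨[NTPP, DC], [TPP, PON, ECN]⟩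
  | DC, TPPi => ⟨[DC], []⟩
  | DC, NTPP => ⟨[TPP, NTPP, PON, PODY, PODZ, ECN, ECD, DC], []⟩
  | DC, NTPPi => ⟨[DC], []⟩
  | DC, PON => ⟨[TPP, NTPP, PON, ECN, DC], []⟩
  | DC, PODY => ⟨[NTPP], []⟩
  | DC, PODZ => ⟨[NTPP], []⟩
  | DC, ECN => ⟨[NTPP, DC], [TPP, PON, ECN]⟩
  | DC, ECD => ⟨[NTPP], []⟩
  | DC, DC => ⟨[one, TPP, TPPi, NTPP, NTPPi, PON, ECN, DC], []⟩

/-- `T` is an entry, marked or not, of the cell specified by `R` and `S`: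
`⟨R, T, S⟩` is a composition triad of the RCC11 table. -/
def IsTriad (R T S : RCC11) : Prop := T ∈ (table R S).plain ∨ T ∈ (table R S).crossed

/-- `⟨R, T, S⟩` is a composition triad whose entry carries no `×`. -/
def IsPlain (R T S : RCC11) : Prop := T ∈ (table R S).plain

end RCC11

/-! Two regions `x`, `y` cut the algebra into four atoms `x ⊓ y`, `x ⊓ yᶜ`, `xᶜ ⊓ y`, `xᶜ ⊓ yᶜ`. As
neither region is `⊥` or `⊤`, either none of them vanishes (`PON`), or two opposite ones do (`1'`,
`ECD`), or exactly one does; in the last case the two regions or complements meeting in that atom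
either touch or do not, which gives the other eight relations. This is `Holds`, and `mem_rel`
identifies it with the definitions.

In this form complementing `x` or `y` permutes the relations, with orbits {`1'`, `ECD`}, {`TPP`,
`TPPi`, `ECN`, `PODY`}, {`NTPP`, `NTPPi`, `DC`, `PODZ`}, {`PON`}. Complementing `x`, `y` or the
intermediate region `z`, and taking converses, therefore acts on the cells, and a finite check shows
that the table is invariant. Besides the cells of `1'`, nine remain: `ECN` with `ECN`, `TPPi`, `DC`,
`NTPPi`, `PON`; `DC` with `DC`, `NTPPi`, `PON`; and `PON` with `PON`.

Unmarked entries need a construction of `z`. The tool is `exists_lt_not_C`: every nonzero `a` has a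
nonzero proper part away from `aᶜ`, which can be added or removed without affecting contacts with
anything below `aᶜ`. Strength enters when two regions out of contact must be separated. For marked
entries, consistency follows by the cycle law from other cells, except for `ECN`, `ECN`, `ECN`,
which is built by hand; extensionality fails on explicit pairs leaving no room for `z`. As these
constructions work in every strong model, the table does not depend on the model. The regular open
sets of the real line show that strong models exist. -/

set_option linter.unusedSimpArgs false

/-! ### Prime ideals of a Boolean algebra as points -/

/-- The points of the Stone space of a Boolean algebra, as prime ideals. -/
def StonePoint (A : Type u) [BooleanAlgebra A] : Type u := {I : Order.Ideal A // I.IsPrime}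

namespace StonePoint

variable {A : Type u} [BooleanAlgebra A]

/-- The point `p` lies in the clopen set of `a`. -/
def Mem (p : StonePoint A) (a : A) : Prop := a ∉ p.1

theorem mem_bot (p : StonePoint A) : p.Mem ⊥ ↔ False := by
  simp [Mem]

theorem mem_sup (p : StonePoint A) (a b : A) : p.Mem (a ⊔ b) ↔ p.Mem a ∨ p.Mem b := by
  simp only [Mem, Order.Ideal.sup_mem_iff]
  tauto

theorem mem_inf (p : StonePoint A) (a b : A) : p.Mem (a ⊓ b) ↔ p.Mem a ∧ p.Mem b := by
  have := p.2
  refine ⟨fun h => ⟨fun ha => h (p.1.lower inf_le_left ha),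
    fun hb => h (p.1.lower inf_le_right hb)⟩, fun h hab => ?_⟩
  exact (this.mem_or_mem hab).elim h.1 h.2

theorem mem_compl (p : StonePoint A) (a : A) : p.Mem aᶜ ↔ ¬p.Mem a := by
  have := p.2
  refine ⟨fun h h' => (this.mem_or_compl_mem (x := a)).elim h' h, fun h h' => ?_⟩
  exact p.2.1.ne_univ (Set.eq_univ_of_forall fun x => p.1.lower le_top (by
    simpa using p.1.sup_mem (not_not.1 h) h'))

theorem mem_top (p : StonePoint A) : p.Mem ⊤ ↔ True := by
  rw [← compl_bot, mem_compl, mem_bot, not_false_iff]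

theorem mem_sdiff (p : StonePoint A) (a b : A) : p.Mem (a \ b) ↔ p.Mem a ∧ ¬p.Mem b := by
  rw [sdiff_eq, mem_inf, mem_compl]

/-- The prime ideal theorem separates `b` from `a` when `a ≤ b` fails. Through this lemma Boolean
facts become pointwise propositional ones, which the recurring `simp only` and `grind` blocks
settle. -/
theorem le_iff_mem (a b : A) : a ≤ b ↔ ∀ p : StonePoint A, p.Mem a → p.Mem b := by
  refine ⟨fun h p ha hb => ha (p.1.lower h hb), fun h => ?_⟩
  by_contra hab
  obtain ⟨J, hJ, hbJ, haJ⟩ := DistribLattice.prime_ideal_of_disjoint_filter_ideal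
    (F := Order.PFilter.principal a) (I := Order.Ideal.principal b)
    (Set.disjoint_left.2 fun x hx hx' => hab (le_trans hx hx'))
  exact h ⟨J, hJ⟩ (fun ha => Set.disjoint_left.1 haJ (le_refl a) ha) (hbJ (le_refl b))

theorem eq_bot_iff_mem (a : A) : a = ⊥ ↔ ∀ p : StonePoint A, ¬p.Mem a := by
  rw [← le_bot_iff, le_iff_mem]
  simp only [mem_bot, imp_false]

theorem eq_top_iff_mem (a : A) : a = ⊤ ↔ ∀ p : StonePoint A, p.Mem a := by
  rw [← top_le_iff, le_iff_mem]
  simp only [mem_top, forall_const]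

end StonePoint

open StonePoint

namespace RCCModel

variable {A : Type u} [BooleanAlgebra A] (M : RCCModel A)

/-! ### The contact relation -/

theorem C_comm {a b : A} : (a, b) ∈ M.C ↔ (b, a) ∈ M.C := ⟨M.symm a b, M.symm b a⟩

/-- The nonzero hypotheses of the axiom can be dropped because `⊥` touches nothing. -/
theorem C_sup {a b c : A} : (a, b ⊔ c) ∈ M.C ↔ (a, b) ∈ M.C ∨ (a, c) ∈ M.C := by
  have hbot (a : A) : (a, ⊥) ∉ M.C := fun h => (M.ne_bot _ _ h).2 rfl
  by_cases ha : a = ⊥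
  · have (b : A) : (a, b) ∉ M.C := fun h => (M.ne_bot _ _ h).1 ha
    simp [this]
  by_cases hb : b = ⊥
  · simp [hb, hbot]
  by_cases hc : c = ⊥
  · simp [hc, hbot]
  exact M.sup a b c ha hb hc

variable {M}

theorem C_mono_right {a b c : A} (h : (a, b) ∈ M.C) (hbc : b ≤ c) : (a, c) ∈ M.C := by
  rw [← sup_eq_right.2 hbc]
  exact M.C_sup.2 (.inl h)

theorem C_mono {a b c d : A} (h : (a, b) ∈ M.C) (hac : a ≤ c) (hbd : b ≤ d) : (c, d) ∈ M.C :=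
  M.C_comm.1 (C_mono_right (M.C_comm.1 (C_mono_right h hbd)) hac)

theorem C_of_inf_ne_bot {a b : A} (h : a ⊓ b ≠ ⊥) : (a, b) ∈ M.C :=
  C_mono (M.refl _ h) inf_le_left inf_le_right

theorem inf_eq_bot_of_not_C {a b : A} (h : (a, b) ∉ M.C) : a ⊓ b = ⊥ :=
  not_not.1 (mt C_of_inf_ne_bot h)

/-- If `a` touches `b` but not `c`, then it touches every region covering `b` outside `c`. -/
theorem C_of_le_sup {a b c d : A} (h : (a, b) ∈ M.C) (hc : (a, c) ∉ M.C) (hd : b ≤ c ⊔ d) :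
    (a, d) ∈ M.C :=
  (M.C_sup.1 (C_mono_right h hd)).resolve_left hc

variable (M)

/-- Below every nonzero `a` there is a nonzero proper `m` away from the complement of `a`. -/
theorem exists_lt_not_C {a : A} (ha : a ≠ ⊥) :
    ∃ m, m ≠ ⊥ ∧ m ≤ a ∧ a \ m ≠ ⊥ ∧ (m, aᶜ) ∉ M.C := by
  by_cases hT : a = ⊤
  -- The complement of `⊤` touches nothing, so any region will do.
  · obtain ⟨x, hx, hxT⟩ := M.exists_ne
    subst hT
    refine ⟨x, hx, le_top, by simpa using hxT, fun h => (M.ne_bot _ _ h).2 compl_top⟩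
  · have hc : aᶜ ≠ ⊥ := by simpa using hT
    have hcT : aᶜ ≠ ⊤ := by simpa using ha
    obtain ⟨m, hm, hmT, h⟩ := M.exists_not _ hc hcT
    have hle : m ≤ a := by
      have := inf_eq_bot_of_not_C h
      simp only [le_iff_mem, eq_bot_iff_mem, eq_top_iff_mem, mem_bot, mem_top, mem_sup, mem_inf,
        mem_compl, mem_sdiff, ne_eq] at *
      grind
    -- If `m` exhausted `a`, then `mᶜ ≤ aᶜ`, and `m`, which touches `mᶜ`, would touch `aᶜ`.
    refine ⟨m, hm, hle, fun h' => h (M.C_comm.1 ?_), fun h' => h (M.C_comm.1 h')⟩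
    refine C_mono_right (M.compl m hm hmT) (compl_le_compl ?_)
    simp only [le_iff_mem, eq_bot_iff_mem, eq_top_iff_mem, mem_bot, mem_top, mem_sup, mem_inf,
      mem_compl, mem_sdiff, ne_eq] at *
    grind

/-! ### The relations in terms of the Boolean structure and contact -/

/-- If `x ≤ y` fails, a region well inside `x ⊓ yᶜ` touches `x` but not `y`; this is extensionality
of contact. -/
theorem mem_P {x y : Region A} : (x, y) ∈ M.P ↔ x.1 ≤ y.1 := by
  constructor
  · intro h
    by_contra hxy
    obtain ⟨m, hm, hmle, -, hmC⟩ := M.exists_lt_not_C (a := x.1 ⊓ y.1ᶜ) (by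
      simp only [le_iff_mem, eq_bot_iff_mem, eq_top_iff_mem, mem_bot, mem_top, mem_sup, mem_inf,
        mem_compl, mem_sdiff, ne_eq] at *
      grind)
    have hmx : m ≤ x.1 := hmle.trans inf_le_left
    refine h ⟨⟨m, hm, fun h => x.2.2 (top_le_iff.1 (h ▸ hmx))⟩, ?_, fun h => hmC ?_⟩
    · exact M.C_comm.1 (C_mono_right (M.refl m hm) hmx)
    · refine C_mono_right h ?_
      simp only [le_iff_mem, eq_bot_iff_mem, eq_top_iff_mem, mem_bot, mem_top, mem_sup, mem_inf,
        mem_compl, mem_sdiff, ne_eq] at *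
      grind
  · rintro h ⟨z, h1, h2⟩
    exact h2 (M.C_comm.1 (C_mono h1 h le_rfl) )

theorem mem_O {x y : Region A} : (x, y) ∈ M.O ↔ x.1 ⊓ y.1 ≠ ⊥ := by
  constructor
  · rintro ⟨z, h1, h2⟩ h
    exact z.2.1 (le_bot_iff.1 ((le_inf (M.mem_P.1 h1) (M.mem_P.1 h2)).trans h.le))
  · intro h
    exact ⟨⟨_, h, fun h' => x.2.2 (top_le_iff.1 (h'.ge.trans inf_le_left))⟩, M.mem_P.2 inf_le_left,
      M.mem_P.2 inf_le_right⟩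

theorem mem_T {x y : Region A} : (x, y) ∈ M.T ↔ x.1 ⊔ y.1 = ⊤ := by
  constructor
  · intro h
    by_contra h'
    exact h ⟨⟨_, fun h' => x.2.1 (le_bot_iff.1 (le_sup_left.trans h'.le)), h'⟩, M.mem_P.2 le_sup_left,
      M.mem_P.2 le_sup_right⟩
  · rintro h ⟨z, h1, h2⟩
    exact z.2.2 (top_le_iff.1 (h.ge.trans (sup_le (M.mem_P.1 h1) (M.mem_P.1 h2))))

/-- The RCC11 relations, by the vanishing of the atoms generated by the two arguments and a
contact. -/
def Holds : RCC11 → A → A → Prop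
  | .one, x, y => x ⊓ yᶜ = ⊥ ∧ xᶜ ⊓ y = ⊥
  | .ECD, x, y => x ⊓ y = ⊥ ∧ xᶜ ⊓ yᶜ = ⊥
  | .TPP, x, y => x ⊓ yᶜ = ⊥ ∧ xᶜ ⊓ y ≠ ⊥ ∧ (x, yᶜ) ∈ M.C
  | .NTPP, x, y => x ⊓ yᶜ = ⊥ ∧ xᶜ ⊓ y ≠ ⊥ ∧ (x, yᶜ) ∉ M.C
  | .TPPi, x, y => xᶜ ⊓ y = ⊥ ∧ x ⊓ yᶜ ≠ ⊥ ∧ (xᶜ, y) ∈ M.C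
  | .NTPPi, x, y => xᶜ ⊓ y = ⊥ ∧ x ⊓ yᶜ ≠ ⊥ ∧ (xᶜ, y) ∉ M.C
  | .ECN, x, y => x ⊓ y = ⊥ ∧ xᶜ ⊓ yᶜ ≠ ⊥ ∧ (x, y) ∈ M.C
  | .DC, x, y => x ⊓ y = ⊥ ∧ xᶜ ⊓ yᶜ ≠ ⊥ ∧ (x, y) ∉ M.C
  | .PODY, x, y => xᶜ ⊓ yᶜ = ⊥ ∧ x ⊓ y ≠ ⊥ ∧ (xᶜ, yᶜ) ∈ M.C
  | .PODZ, x, y => xᶜ ⊓ yᶜ = ⊥ ∧ x ⊓ y ≠ ⊥ ∧ (xᶜ, yᶜ) ∉ M.C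
  | .PON, x, y => x ⊓ y ≠ ⊥ ∧ x ⊓ yᶜ ≠ ⊥ ∧ xᶜ ⊓ y ≠ ⊥ ∧ xᶜ ⊓ yᶜ ≠ ⊥

variable {M}

theorem compl_region (x : Region A) : x.1ᶜ ≠ ⊥ ∧ x.1ᶜ ≠ ⊤ := by
  simpa using x.2.symm

/-- The complement of a region. -/
def regionCompl (x : Region A) : Region A := ⟨x.1ᶜ, compl_region x⟩

theorem inf_compl_eq_bot_iff {a b : A} : a ⊓ bᶜ = ⊥ ↔ a ≤ b := by
  rw [← sdiff_eq, sdiff_eq_bot_iff]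

theorem compl_inf_eq_bot_iff {a b : A} : aᶜ ⊓ b = ⊥ ↔ b ≤ a := by
  rw [inf_comm, inf_compl_eq_bot_iff]

theorem compl_inf_compl_eq_bot_iff {a b : A} : aᶜ ⊓ bᶜ = ⊥ ↔ a ⊔ b = ⊤ := by
  rw [← compl_sup, compl_eq_bot]

/-- No proper region is away from its complement. -/
theorem not_le_of_not_C {x y : A} (hx : x ≠ ⊥ ∧ x ≠ ⊤) (h : (x, yᶜ) ∉ M.C) : ¬y ≤ x :=
  fun hle => h (C_mono_right (M.compl x hx.1 hx.2) (compl_le_compl hle))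

theorem mem_EC {x y : Region A} : (x, y) ∈ M.EC ↔ x.1 ⊓ y.1 = ⊥ ∧ (x.1, y.1) ∈ M.C := by
  rw [EC, Set.mem_inter_iff, Set.mem_compl_iff, mem_O, not_not, and_comm]
  rfl

theorem mem_PP {x y : Region A} : (x, y) ∈ M.PP ↔ x.1 ≤ y.1 ∧ ¬y.1 ≤ x.1 := by
  have : (x, y) ∈ M.PP ↔ (x, y) ∈ M.P ∧ ¬((x, y) ∈ M.P ∧ (y, x) ∈ M.P) := Iff.rfl
  rw [this, mem_P, mem_P]
  tauto

theorem mem_ECD {x y : Region A} : (x, y) ∈ M.ECD ↔ y.1 = x.1ᶜ := by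
  rw [ECD, Set.mem_inter_iff, Set.mem_compl_iff, mem_O, not_not, mem_T, eq_comm (a := y.1),
    compl_eq_iff_isCompl, isCompl_iff, disjoint_iff, codisjoint_iff]

/-- Every region externally connected to `y` lies in `yᶜ`, so `yᶜ` is the best intermediate region
for `EC ○ EC`. -/
theorem mem_TPP {x y : Region A} :
    (x, y) ∈ M.TPP ↔ x.1 ≤ y.1 ∧ ¬y.1 ≤ x.1 ∧ (x.1, y.1ᶜ) ∈ M.C := by
  rw [TPP, Set.mem_inter_iff, mem_PP, and_assoc]
  refine and_congr_right fun h => and_congr_right fun h' => ⟨?_, fun hC => ?_⟩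
  · rintro ⟨z, h1, h2⟩
    replace h1 := mem_EC.1 h1
    replace h2 := mem_EC.1 h2
    refine C_mono_right h1.2 ?_
    have := h2.1
    simp only [le_iff_mem, eq_bot_iff_mem, eq_top_iff_mem, mem_bot, mem_top, mem_sup, mem_inf,
      mem_compl, mem_sdiff, ne_eq] at *
    grind
  · refine ⟨regionCompl y, mem_EC.2 ⟨inf_compl_eq_bot_iff.2 h, hC⟩,
      mem_EC.2 ⟨compl_inf_self _, ?_⟩⟩
    exact M.C_comm.1 (M.compl y.1 y.2.1 y.2.2)

/-- Proper parthood comes for free: lack of contact with `yᶜ` forces `x ≤ y`, and `x = y` is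
excluded because `x` touches `xᶜ`. -/
theorem mem_NTPP {x y : Region A} : (x, y) ∈ M.NTPP ↔ (x.1, y.1ᶜ) ∉ M.C := by
  rw [NTPP, Set.mem_inter_iff, Set.mem_compl_iff, mem_PP, mem_TPP]
  constructor
  · tauto
  · intro h
    exact ⟨⟨inf_compl_eq_bot_iff.1 (inf_eq_bot_of_not_C h), not_le_of_not_C x.2 h⟩,
      fun h' => h h'.2.2⟩

/-- The only region `ECD` to `x` is `xᶜ`, so `PODZ` is `NTPP` with the first argument complemented.
-/
theorem mem_PODZ {x y : Region A} : (x, y) ∈ M.PODZ ↔ (x.1ᶜ, y.1ᶜ) ∉ M.C := by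
  constructor
  · rintro ⟨z, h1, h2⟩
    rw [← mem_ECD.1 h1]
    exact mem_NTPP.1 h2
  · intro h
    exact ⟨regionCompl x, mem_ECD.2 rfl, mem_NTPP.2 h⟩

theorem mem_rel {Q : RCC11} {x y : Region A} : (x, y) ∈ M.rel Q ↔ M.Holds Q x.1 y.1 := by
  obtain ⟨hx, hxT⟩ := x.2
  obtain ⟨hy, hyT⟩ := y.2
  have hxc := compl_region x
  have hPOD : (x, y) ∈ M.POD ↔ x.1 ⊓ y.1 ≠ ⊥ ∧ ¬(x.1 ≤ y.1 ∨ y.1 ≤ x.1) ∧ x.1 ⊔ y.1 = ⊤ := by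
    rw [← mem_O, ← mem_T, ← mem_P, ← mem_P, ← and_assoc]
    rfl
  have hPODZ : (x, y) ∈ M.PODZ ↔ M.Holds .PODZ x.1 y.1 := by
    rw [mem_PODZ]
    refine ⟨fun h => ⟨inf_eq_bot_of_not_C h, fun h' => ?_, h⟩, fun h => h.2.2⟩
    refine not_le_of_not_C hxc h ?_
    simp only [le_iff_mem, eq_bot_iff_mem, eq_top_iff_mem, mem_bot, mem_top, mem_sup, mem_inf,
      mem_compl, mem_sdiff, ne_eq] at *
    grind
  cases Q
  case one =>
    have : (x, y) ∈ M.One ↔ (x, y) ∈ M.P ∧ (y, x) ∈ M.P := Iff.rfl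
    simp only [rel, this, Holds, mem_P, inf_compl_eq_bot_iff, compl_inf_eq_bot_iff]
  case TPP =>
    simp only [rel, mem_TPP, Holds, ne_eq, inf_compl_eq_bot_iff, compl_inf_eq_bot_iff]
  case TPPi =>
    simp only [rel, SetRel.mem_inv, mem_TPP, Holds, ne_eq, inf_compl_eq_bot_iff,
      compl_inf_eq_bot_iff, M.C_comm (b := y.1)]
  case NTPP =>
    simp only [rel, mem_NTPP, Holds, ne_eq, inf_compl_eq_bot_iff, compl_inf_eq_bot_iff]
    exact ⟨fun h => ⟨inf_compl_eq_bot_iff.1 (inf_eq_bot_of_not_C h), not_le_of_not_C x.2 h, h⟩,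
      fun h => h.2.2⟩
  case NTPPi =>
    simp only [rel, SetRel.mem_inv, mem_NTPP, Holds, ne_eq, inf_compl_eq_bot_iff,
      compl_inf_eq_bot_iff, M.C_comm (b := y.1)]
    exact ⟨fun h => ⟨inf_compl_eq_bot_iff.1 (inf_eq_bot_of_not_C h), not_le_of_not_C y.2 h, h⟩,
      fun h => h.2.2⟩
  case PON =>
    have : (x, y) ∈ M.PON ↔ ((x, y) ∈ M.O ∧ ¬((x, y) ∈ M.P ∨ (y, x) ∈ M.P)) ∧ (x, y) ∉ M.T :=
      Iff.rfl
    simp only [rel, this, Holds, mem_P, mem_O, mem_T, ne_eq, compl_inf_compl_eq_bot_iff]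
    simp only [inf_compl_eq_bot_iff, compl_inf_eq_bot_iff]
    exact ⟨fun ⟨⟨h1, h2⟩, h3⟩ => ⟨h1, fun h => h2 (.inl h), fun h => h2 (.inr h), h3⟩,
      fun ⟨h1, h2, h3, h4⟩ => ⟨⟨h1, fun h => h.elim h2 h3⟩, h4⟩⟩
  case PODY =>
    have : (x, y) ∈ M.PODY ↔ (x, y) ∈ M.POD ∧ (x, y) ∉ M.PODZ := Iff.rfl
    simp only [rel, this, hPOD, hPODZ, Holds, compl_inf_compl_eq_bot_iff]
    constructor
    · rintro ⟨⟨h2, -, h1⟩, h⟩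
      exact ⟨h1, h2, not_not.1 fun h3 => h ⟨h1, h2, h3⟩⟩
    · rintro ⟨h1, h2, h3⟩
      refine ⟨⟨h2, ?_, h1⟩, fun h => h.2.2 h3⟩
      rintro (h | h)
      · exact hyT (by rwa [sup_eq_right.2 h] at h1)
      · exact hxT (by rwa [sup_eq_left.2 h] at h1)
  case PODZ => exact hPODZ
  case ECN =>
    have : (x, y) ∈ M.ECN ↔ (x, y) ∈ M.EC ∧ ¬((x, y) ∉ M.O ∧ (x, y) ∈ M.T) := Iff.rfl
    simp only [rel, this, mem_EC, mem_O, mem_T, Holds, ne_eq, compl_inf_compl_eq_bot_iff]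
    tauto
  case ECD =>
    have : (x, y) ∈ M.ECD ↔ (x, y) ∉ M.O ∧ (x, y) ∈ M.T := Iff.rfl
    simp only [rel, this, mem_O, mem_T, Holds, ne_eq, compl_inf_compl_eq_bot_iff, not_not]
  case DC =>
    have : (x, y) ∈ M.DC ↔ (x.1, y.1) ∉ M.C := Iff.rfl
    simp only [rel, this, Holds, ne_eq]
    refine ⟨fun h => ⟨inf_eq_bot_of_not_C h, fun h' => ?_, h⟩, fun h => h.2.2⟩
    refine not_le_of_not_C (y := y.1ᶜ) x.2 (by rwa [compl_compl]) ?_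
    simp only [le_iff_mem, eq_bot_iff_mem, eq_top_iff_mem, mem_bot, mem_top, mem_sup, mem_inf,
      mem_compl, mem_sdiff, ne_eq] at *
    grind

end RCCModel

/-! ### Symmetries of the composition table -/

namespace RCC11

/-- The relation between `xᶜ` and `y` when the given one holds between `x` and `y`. -/
def complLeft : RCC11 → RCC11
  | one => ECD | ECD => one | TPP => PODY | PODY => TPP | TPPi => ECN | ECN => TPPi
  | NTPP => PODZ | PODZ => NTPP | NTPPi => DC | DC => NTPPi | PON => PON

/-- The relation between `x` and `yᶜ` when the given one holds between `x` and `y`. -/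
def complRight : RCC11 → RCC11
  | one => ECD | ECD => one | TPP => ECN | ECN => TPP | TPPi => PODY | PODY => TPPi
  | NTPP => DC | DC => NTPP | NTPPi => PODZ | PODZ => NTPPi | PON => PON

/-- The converse relation. -/
def conv : RCC11 → RCC11
  | TPP => TPPi | TPPi => TPP | NTPP => NTPPi | NTPPi => NTPP | Q => Q

theorem complLeft_complLeft (Q : RCC11) : Q.complLeft.complLeft = Q := by cases Q <;> rfl

theorem complRight_complRight (Q : RCC11) : Q.complRight.complRight = Q := by cases Q <;> rfl

theorem conv_conv (Q : RCC11) : Q.conv.conv = Q := by cases Q <;> rfl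

instance : DecidableEq RCC11 := fun a b =>
  decidable_of_iff (a.ctorIdx = b.ctorIdx) (by cases a <;> cases b <;> simp [RCC11.ctorIdx])

instance : Fintype RCC11 :=
  ⟨{one, TPP, TPPi, NTPP, NTPPi, PON, PODY, PODZ, ECN, ECD, DC}, fun a => by cases a <;> decide⟩

instance (R T S : RCC11) : Decidable (IsPlain R T S) :=
  inferInstanceAs (Decidable (T ∈ (table R S).plain))

instance (R T S : RCC11) : Decidable (IsTriad R T S) :=
  inferInstanceAs (Decidable (T ∈ (table R S).plain ∨ T ∈ (table R S).crossed))

/-- The invariance of the table under the symmetries, here and in the next five lemmas, is a check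
over all 11³ triples. -/
theorem isPlain_left : ∀ R T S, IsPlain R.complLeft T.complLeft S ↔ IsPlain R T S := by
  decide +kernel

theorem isTriad_left : ∀ R T S, IsTriad R.complLeft T.complLeft S ↔ IsTriad R T S := by
  decide +kernel

theorem isPlain_mid : ∀ R T S, IsPlain R.complRight T S.complLeft ↔ IsPlain R T S := by
  decide +kernel

theorem isTriad_mid : ∀ R T S, IsTriad R.complRight T S.complLeft ↔ IsTriad R T S := by
  decide +kernel

theorem isPlain_conv : ∀ R T S, IsPlain S.conv T.conv R.conv ↔ IsPlain R T S := by
  decide +kernel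

theorem isTriad_conv : ∀ R T S, IsTriad S.conv T.conv R.conv ↔ IsTriad R T S := by
  decide +kernel

end RCC11

namespace RCCModel

variable {A : Type u} [BooleanAlgebra A] {M : RCCModel A}

open RCC11

theorem holds_complLeft (Q : RCC11) (x y : A) : M.Holds Q.complLeft x y ↔ M.Holds Q xᶜ y := by
  cases Q <;> simp [Holds, complLeft] <;> tauto

theorem holds_complRight (Q : RCC11) (x y : A) : M.Holds Q.complRight x y ↔ M.Holds Q x yᶜ := by
  cases Q <;> simp [Holds, complRight]
  tauto

theorem holds_conv (Q : RCC11) (x y : A) : M.Holds Q.conv x y ↔ M.Holds Q y x := by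
  cases Q <;> simp only [Holds, conv, inf_comm y, inf_comm yᶜ, M.C_comm (a := y),
    M.C_comm (a := yᶜ)] <;> tauto

/-! ### Correctness of a cell and its transport along the symmetries -/

/-- The relation `Q` meets `R ○ S`. -/
def Consistent (M : RCCModel A) (R Q S : RCC11) : Prop :=
  ∃ x y z : Region A, M.Holds Q x.1 y.1 ∧ M.Holds R x.1 z.1 ∧ M.Holds S z.1 y.1

/-- The relation `Q` is contained in `R ○ S`. -/
def Extensional (M : RCCModel A) (R Q S : RCC11) : Prop :=
  ∀ x y : Region A, M.Holds Q x.1 y.1 → ∃ z : Region A, M.Holds R x.1 z.1 ∧ M.Holds S z.1 y.1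

/-- The composition table is correct for the given triple of relations. -/
def Correct (M : RCCModel A) (R Q S : RCC11) : Prop :=
  (M.Consistent R Q S ↔ IsTriad R Q S) ∧ (M.Extensional R Q S ↔ IsPlain R Q S)

/-- The composition table is correct at the given cell. -/
def CorrectCell (M : RCCModel A) (R S : RCC11) : Prop := ∀ Q, M.Correct R Q S

variable {R Q S : RCC11}

theorem Consistent.left (h : M.Consistent R Q S) : M.Consistent R.complLeft Q.complLeft S := by
  obtain ⟨x, y, z, h1, h2, h3⟩ := h
  refine ⟨regionCompl x, y, z, ?_, ?_, h3⟩ <;> rw [holds_complLeft] <;> simpa [regionCompl]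

theorem Extensional.left (h : M.Extensional R Q S) :
    M.Extensional R.complLeft Q.complLeft S := by
  intro x y hxy
  obtain ⟨z, h1, h2⟩ := h (regionCompl x) y ((holds_complLeft _ _ _).1 hxy)
  exact ⟨z, (holds_complLeft _ _ _).2 h1, h2⟩

theorem Consistent.mid (h : M.Consistent R Q S) : M.Consistent R.complRight Q S.complLeft := by
  obtain ⟨x, y, z, h1, h2, h3⟩ := h
  refine ⟨x, y, regionCompl z, h1, (holds_complRight _ _ _).2 ?_, (holds_complLeft _ _ _).2 ?_⟩ <;>
    simpa [regionCompl]

theorem Extensional.mid (h : M.Extensional R Q S) :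
    M.Extensional R.complRight Q S.complLeft := by
  intro x y hxy
  obtain ⟨z, h1, h2⟩ := h x y hxy
  refine ⟨regionCompl z, (holds_complRight _ _ _).2 ?_, (holds_complLeft _ _ _).2 ?_⟩ <;>
    simpa [regionCompl]

theorem Consistent.conv (h : M.Consistent R Q S) : M.Consistent S.conv Q.conv R.conv := by
  obtain ⟨x, y, z, h1, h2, h3⟩ := h
  exact ⟨y, x, z, (holds_conv _ _ _).2 h1, (holds_conv _ _ _).2 h3, (holds_conv _ _ _).2 h2⟩

theorem Extensional.conv (h : M.Extensional R Q S) : M.Extensional S.conv Q.conv R.conv := by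
  intro x y hxy
  obtain ⟨z, h1, h2⟩ := h y x ((holds_conv _ _ _).1 hxy)
  exact ⟨z, (holds_conv _ _ _).2 h2, (holds_conv _ _ _).2 h1⟩

/-- The cycle law. -/
theorem Consistent.cycle (h : M.Consistent R Q S) : M.Consistent R.conv S Q := by
  obtain ⟨x, y, z, h1, h2, h3⟩ := h
  exact ⟨z, y, x, h3, (holds_conv _ _ _).2 h2, h1⟩

/-- Since `complLeft` is an involution, transporting consistency and extensionality in one direction
yields both equivalences. -/
theorem CorrectCell.left (h : M.CorrectCell R.complLeft S) : M.CorrectCell R S := by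
  intro Q
  obtain ⟨h1, h2⟩ := h Q.complLeft
  rw [isTriad_left] at h1
  rw [isPlain_left] at h2
  rw [Correct, ← h1, ← h2]
  exact ⟨⟨.left, fun h => by simpa only [complLeft_complLeft] using h.left⟩,
    ⟨.left, fun h => by simpa only [complLeft_complLeft] using h.left⟩⟩

theorem CorrectCell.mid (h : M.CorrectCell R.complRight S.complLeft) : M.CorrectCell R S := by
  intro Q
  obtain ⟨h1, h2⟩ := h Q
  rw [isTriad_mid] at h1
  rw [isPlain_mid] at h2
  rw [Correct, ← h1, ← h2]
  exact ⟨⟨.mid, fun h => by simpa only [complLeft_complLeft, complRight_complRight] using h.mid⟩,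
    ⟨.mid, fun h => by simpa only [complLeft_complLeft, complRight_complRight] using h.mid⟩⟩

theorem CorrectCell.conv (h : M.CorrectCell S.conv R.conv) : M.CorrectCell R S := by
  intro Q
  obtain ⟨h1, h2⟩ := h Q.conv
  rw [isTriad_conv] at h1
  rw [isPlain_conv] at h2
  rw [Correct, ← h1, ← h2]
  exact ⟨⟨.conv, fun h => by simpa only [conv_conv] using h.conv⟩,
    ⟨.conv, fun h => by simpa only [conv_conv] using h.conv⟩⟩

theorem conv_complRight (Q : RCC11) : Q.complRight.conv = Q.conv.complLeft := by cases Q <;> rfl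

/-- Complementing `y` is complementing `x` conjugated by the converse. -/
theorem CorrectCell.right (h : M.CorrectCell R S.complRight) : M.CorrectCell R S := by
  refine .conv (.left (.conv ?_))
  rwa [← conv_complRight, conv_conv, conv_conv]

theorem consistent_iff :
    M.Consistent R Q S ↔ (M.rel Q ∩ (M.rel R ○ M.rel S)).Nonempty := by
  simp only [Consistent, ← mem_rel]
  exact ⟨fun ⟨x, y, z, h1, h2, h3⟩ => ⟨(x, y), h1, z, h2, h3⟩,
    fun ⟨⟨x, y⟩, h1, z, h2, h3⟩ => ⟨x, y, z, h1, h2, h3⟩⟩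

theorem extensional_iff : M.Extensional R Q S ↔ M.rel Q ⊆ M.rel R ○ M.rel S := by
  simp only [Extensional, ← mem_rel]
  exact ⟨fun h ⟨x, y⟩ hxy => h x y hxy, fun h x y hxy => h hxy⟩

/-! ### Disjointness and non-emptiness of the relations -/

/-- Two adjacent atoms cannot both vanish (`h1` to `h4`), so the vanishing pattern together with one
contact determines the relation. -/
theorem Holds.unique {x y : Region A} (h : M.Holds R x.1 y.1) (h' : M.Holds S x.1 y.1) :
    R = S := by
  have h1 : ¬(x.1 ⊓ y.1 = ⊥ ∧ x.1 ⊓ y.1ᶜ = ⊥) := fun h => x.2.1 (by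
    simp only [le_iff_mem, eq_bot_iff_mem, eq_top_iff_mem, mem_bot, mem_top, mem_sup, mem_inf,
      mem_compl, mem_sdiff, ne_eq] at *
    grind)
  have h2 : ¬(x.1ᶜ ⊓ y.1 = ⊥ ∧ x.1ᶜ ⊓ y.1ᶜ = ⊥) := fun h => x.2.2 (by
    simp only [le_iff_mem, eq_bot_iff_mem, eq_top_iff_mem, mem_bot, mem_top, mem_sup, mem_inf,
      mem_compl, mem_sdiff, ne_eq] at *
    grind)
  have h3 : ¬(x.1 ⊓ y.1 = ⊥ ∧ x.1ᶜ ⊓ y.1 = ⊥) := fun h => y.2.1 (by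
    simp only [le_iff_mem, eq_bot_iff_mem, eq_top_iff_mem, mem_bot, mem_top, mem_sup, mem_inf,
      mem_compl, mem_sdiff, ne_eq] at *
    grind)
  have h4 : ¬(x.1 ⊓ y.1ᶜ = ⊥ ∧ x.1ᶜ ⊓ y.1ᶜ = ⊥) := fun h => y.2.2 (by
    simp only [le_iff_mem, eq_bot_iff_mem, eq_top_iff_mem, mem_bot, mem_top, mem_sup, mem_inf,
      mem_compl, mem_sdiff, ne_eq] at *
    grind)
  cases R <;> simp only [Holds, ne_eq] at h <;> cases S <;> first | rfl | skip
  all_goals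
    exfalso
    simp only [Holds, ne_eq] at h'
    clear * - h h' h1 h2 h3 h4
    -- Only the truth values of the four vanishing conditions matter now.
    generalize (x.1 ⊓ y.1 = ⊥) = p, (x.1 ⊓ y.1ᶜ = ⊥) = q, (x.1ᶜ ⊓ y.1 = ⊥) = r,
      (x.1ᶜ ⊓ y.1ᶜ = ⊥) = s at *
    grind only

/-! ### Constructions of regions -/

theorem exists_region (M : RCCModel A) : Nonempty (Region A) :=
  let ⟨x, hx⟩ := M.exists_ne
  ⟨⟨x, hx⟩⟩

/-- A proper region inside `a` touches its relative complement in `a`. -/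
theorem C_sdiff {a m : A} (hm : m ≠ ⊥ ∧ m ≠ ⊤) (h : (m, aᶜ) ∉ M.C) : (m, a \ m) ∈ M.C := by
  refine C_of_le_sup (M.compl m hm.1 hm.2) h ?_
  simp only [le_iff_mem, eq_bot_iff_mem, eq_top_iff_mem, mem_bot, mem_top, mem_sup, mem_inf,
    mem_compl, mem_sdiff, ne_eq] at *
  grind

/-- The witness is `yᶜ` with a piece `m` away from `y` removed. Removing `m` costs no contact with
`x ≤ y` or with `y`, and makes the witness different from `yᶜ`. -/
theorem exists_ECN_left_ECN {x y : Region A} (h : x.1 ⊓ y.1ᶜ = ⊥) (hC : (x.1, y.1ᶜ) ∈ M.C) :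
    ∃ z : Region A, M.Holds .ECN x.1 z.1 ∧ M.Holds .ECN z.1 y.1 := by
  obtain ⟨m, hm, hle, hne, hmC⟩ := M.exists_lt_not_C (compl_region y).1
  rw [compl_compl] at hmC
  have hle' : y.1ᶜ ≤ m ⊔ y.1ᶜ \ m := le_sup_sdiff
  have h1 : (x.1, y.1ᶜ \ m) ∈ M.C := by
    refine C_of_le_sup hC (fun h' => hmC (C_mono (M.C_comm.1 h') le_rfl ?_)) hle'
    exact inf_compl_eq_bot_iff.1 h
  have h2 : (y.1ᶜ \ m, y.1) ∈ M.C :=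
    M.C_comm.1 (C_of_le_sup (M.compl _ y.2.1 y.2.2) (fun h' => hmC (M.C_comm.1 h')) hle')
  have hy := y.2
  refine ⟨⟨y.1ᶜ \ m, hne, ?_⟩, ⟨?_, ?_, h1⟩, ?_, ?_, h2⟩ <;> (try dsimp only) <;> clear hmC hC <;>
    simp only [le_iff_mem, eq_bot_iff_mem, eq_top_iff_mem, mem_bot, mem_top, mem_sup, mem_inf,
      mem_compl, mem_sdiff, ne_eq] at * <;> grind

theorem exists_DC {a : A} (ha : a ≠ ⊤) :
    ∃ z, z ≠ ⊥ ∧ z ≤ aᶜ ∧ aᶜ \ z ≠ ⊥ ∧ (z, a) ∉ M.C := by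
  obtain ⟨z, h1, h2, h3, h4⟩ := M.exists_lt_not_C (a := aᶜ) (by simpa using ha)
  exact ⟨z, h1, h2, h3, by rwa [compl_compl] at h4⟩

/-- A part of `a` that is nonzero and proper if `a` is nonzero. -/
theorem exists_half (M : RCCModel A) (a : A) :
    ∃ m ≤ a, a ≠ ⊥ → m ≠ ⊥ ∧ a \ m ≠ ⊥ := by
  by_cases ha : a = ⊥
  · exact ⟨⊥, bot_le, fun h => (h ha).elim⟩
  · obtain ⟨m, h1, h2, h3, -⟩ := M.exists_lt_not_C ha
    exact ⟨m, h2, fun _ => ⟨h1, h3⟩⟩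

theorem IsStrong.exists_between (hM : M.IsStrong) {x y : Region A} (h : (x.1, y.1ᶜ) ∉ M.C) :
    ∃ w : Region A, (x.1, w.1ᶜ) ∉ M.C ∧ (w.1, y.1ᶜ) ∉ M.C := by
  obtain ⟨w, h1, h2⟩ := hM x y (mem_NTPP.2 h)
  exact ⟨w, mem_NTPP.1 h1, mem_NTPP.1 h2⟩

theorem le_of_not_C {a b : A} (h : (a, bᶜ) ∉ M.C) : a ≤ b :=
  inf_compl_eq_bot_iff.1 (inf_eq_bot_of_not_C h)

theorem le_compl_of_not_C {a b : A} (h : (a, b) ∉ M.C) : a ≤ bᶜ :=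
  le_of_not_C (by rwa [compl_compl])

/-! ### Generic arguments for cells -/

theorem exists_holds_complRight (h : ∃ x y : Region A, M.Holds Q x.1 y.1) :
    ∃ x y : Region A, M.Holds Q.complRight x.1 y.1 := by
  obtain ⟨x, y, h⟩ := h
  refine ⟨x, regionCompl y, (holds_complRight _ _ _).2 ?_⟩
  simpa [regionCompl]

theorem exists_holds_complLeft (h : ∃ x y : Region A, M.Holds Q x.1 y.1) :
    ∃ x y : Region A, M.Holds Q.complLeft x.1 y.1 := by
  obtain ⟨x, y, h⟩ := h
  refine ⟨regionCompl x, y, (holds_complLeft _ _ _).2 ?_⟩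
  simpa [regionCompl]

theorem exists_PON (x : Region A) : ∃ y : Region A, M.Holds .PON x.1 y.1 := by
  obtain ⟨m, hm, hm', hm'', -⟩ := M.exists_lt_not_C x.2.1
  obtain ⟨n, hn, hn', hn'', -⟩ := M.exists_lt_not_C (compl_region x).1
  have hx := x.2
  refine ⟨⟨m ⊔ n, ?_, ?_⟩, ?_, ?_, ?_, ?_⟩ <;> (try dsimp only) <;>
    simp only [le_iff_mem, eq_bot_iff_mem, eq_top_iff_mem, mem_bot, mem_top, mem_sup, mem_inf,
      mem_compl, mem_sdiff, ne_eq] at * <;> grind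

/-- One relation per orbit of the complements suffices. Non-emptiness is what makes extensional
triples consistent. -/
theorem exists_holds (M : RCCModel A) (Q : RCC11) : ∃ x y : Region A, M.Holds Q x.1 y.1 := by
  obtain ⟨x⟩ := M.exists_region
  have h1 : ∃ x y : Region A, M.Holds .one x.1 y.1 :=
    ⟨x, x, inf_compl_self _, compl_inf_self _⟩
  have h2 : ∃ x y : Region A, M.Holds .ECN x.1 y.1 := by
    obtain ⟨z, hz, -⟩ := exists_ECN_left_ECN (inf_compl_self x.1) (M.compl _ x.2.1 x.2.2)
    exact ⟨x, z, hz⟩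
  have h3 : ∃ x y : Region A, M.Holds .DC x.1 y.1 := by
    obtain ⟨z, h1, h2, h3, h4⟩ := exists_DC (M := M) x.2.2
    refine ⟨x, ⟨z, h1, fun h => h3 ?_⟩, ?_, ?_, fun h => h4 (M.C_comm.1 h)⟩ <;>
      (try dsimp only at *) <;>
      simp only [le_iff_mem, eq_bot_iff_mem, eq_top_iff_mem, mem_bot, mem_top, mem_sup, mem_inf,
        mem_compl, mem_sdiff, ne_eq] at * <;> grind
  cases Q
  case one => exact h1
  case ECD => exact exists_holds_complRight h1
  case ECN => exact h2
  case TPP => exact exists_holds_complRight h2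
  case TPPi => exact exists_holds_complLeft h2
  case PODY => exact exists_holds_complLeft (exists_holds_complRight h2)
  case DC => exact h3
  case NTPP => exact exists_holds_complRight h3
  case NTPPi => exact exists_holds_complLeft h3
  case PODZ => exact exists_holds_complLeft (exists_holds_complRight h3)
  case PON => exact ⟨x, exists_PON x⟩

theorem Extensional.consistent (h : M.Extensional R Q S) : M.Consistent R Q S := by
  obtain ⟨x, y, hxy⟩ := M.exists_holds Q
  obtain ⟨z, h1, h2⟩ := h x y hxy
  exact ⟨x, y, z, hxy, h1, h2⟩

theorem correct_of_extensional (h : M.Extensional R Q S) (hQ : IsPlain R Q S) :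
    M.Correct R Q S :=
  ⟨iff_of_true h.consistent (.inl hQ), iff_of_true h hQ⟩

theorem correct_of_not_consistent (h : ¬M.Consistent R Q S) (hQ : ¬IsTriad R Q S) :
    M.Correct R Q S :=
  ⟨iff_of_false h hQ, iff_of_false (fun h' => h h'.consistent) (fun h' => hQ (.inl h'))⟩

theorem correct_of_consistent_of_not_extensional (h : M.Consistent R Q S)
    (h' : ¬M.Extensional R Q S) (hQ : IsTriad R Q S) (hQ' : ¬IsPlain R Q S) : M.Correct R Q S :=
  ⟨iff_of_true h hQ, iff_of_false h' hQ'⟩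

/-! ### The cells of `1'` -/

theorem correctCell_one (S : RCC11) : M.CorrectCell .one S := by
  have heq {x z : A} (h : M.Holds .one x z) : x = z :=
    le_antisymm (inf_compl_eq_bot_iff.1 h.1) (compl_inf_eq_bot_iff.1 h.2)
  intro Q
  by_cases hQ : Q = S
  · subst hQ
    exact correct_of_extensional (fun x y h => ⟨x, ⟨inf_compl_self _, compl_inf_self _⟩, h⟩)
      (by revert Q; decide)
  · refine correct_of_not_consistent ?_ (by revert Q S; decide)
    rintro ⟨x, y, z, h1, h2, h3⟩
    obtain rfl : x = z := Subtype.ext (heq h2)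
    exact hQ (h1.unique h3)

/-! ### The cells of `PON` -/

/-- Every entry is extensional: let `z` contain half of each nonzero atom of `x` and `y`. Each of
`x`, `xᶜ`, `y`, `yᶜ` contains a nonzero atom, hence meets both `z` and `zᶜ`. -/
theorem correctCell_PON_PON : M.CorrectCell .PON .PON := by
  intro Q
  refine correct_of_extensional (fun x y _ => ?_) (by revert Q; decide)
  have hx := x.2
  have hy := y.2
  obtain ⟨a, ha, ha'⟩ := M.exists_half (x.1 ⊓ y.1)
  obtain ⟨b, hb, hb'⟩ := M.exists_half (x.1 ⊓ y.1ᶜ)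
  obtain ⟨c, hc, hc'⟩ := M.exists_half (x.1ᶜ ⊓ y.1)
  obtain ⟨d, hd, hd'⟩ := M.exists_half (x.1ᶜ ⊓ y.1ᶜ)
  have hx1 : x.1 ⊓ y.1 ≠ ⊥ ∨ x.1 ⊓ y.1ᶜ ≠ ⊥ := by
    by_contra!
    simp only [le_iff_mem, eq_bot_iff_mem, eq_top_iff_mem, mem_bot, mem_top, mem_sup, mem_inf,
      mem_compl, mem_sdiff, ne_eq] at *
    grind
  have hx2 : x.1ᶜ ⊓ y.1 ≠ ⊥ ∨ x.1ᶜ ⊓ y.1ᶜ ≠ ⊥ := by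
    by_contra!
    simp only [le_iff_mem, eq_bot_iff_mem, eq_top_iff_mem, mem_bot, mem_top, mem_sup, mem_inf,
      mem_compl, mem_sdiff, ne_eq] at *
    grind
  have hy1 : x.1 ⊓ y.1 ≠ ⊥ ∨ x.1ᶜ ⊓ y.1 ≠ ⊥ := by
    by_contra!
    simp only [le_iff_mem, eq_bot_iff_mem, eq_top_iff_mem, mem_bot, mem_top, mem_sup, mem_inf,
      mem_compl, mem_sdiff, ne_eq] at *
    grind
  have hy2 : x.1 ⊓ y.1ᶜ ≠ ⊥ ∨ x.1ᶜ ⊓ y.1ᶜ ≠ ⊥ := by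
    by_contra!
    simp only [le_iff_mem, eq_bot_iff_mem, eq_top_iff_mem, mem_bot, mem_top, mem_sup, mem_inf,
      mem_compl, mem_sdiff, ne_eq] at *
    grind
  have key1 : x.1 ⊓ (a ⊔ b ⊔ c ⊔ d) ≠ ⊥ := by
    rcases hx1 with h | h
    · obtain ⟨h1, h2⟩ := ha' h
      clear * - h1 ha
      simp only [le_iff_mem, eq_bot_iff_mem, eq_top_iff_mem, mem_bot, mem_top, mem_sup, mem_inf,
        mem_compl, mem_sdiff, ne_eq] at *
      grind
    · obtain ⟨h1, h2⟩ := hb' h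
      clear * - h1 hb
      simp only [le_iff_mem, eq_bot_iff_mem, eq_top_iff_mem, mem_bot, mem_top, mem_sup, mem_inf,
        mem_compl, mem_sdiff, ne_eq] at *
      grind
  have key2 : x.1 ⊓ (a ⊔ b ⊔ c ⊔ d)ᶜ ≠ ⊥ := by
    rcases hx1 with h | h
    · obtain ⟨h1, h2⟩ := ha' h
      clear * - h2 ha hb hc hd
      simp only [le_iff_mem, eq_bot_iff_mem, eq_top_iff_mem, mem_bot, mem_top, mem_sup, mem_inf,
        mem_compl, mem_sdiff, ne_eq] at *
      grind
    · obtain ⟨h1, h2⟩ := hb' h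
      clear * - h2 ha hb hc hd
      simp only [le_iff_mem, eq_bot_iff_mem, eq_top_iff_mem, mem_bot, mem_top, mem_sup, mem_inf,
        mem_compl, mem_sdiff, ne_eq] at *
      grind
  have key3 : x.1ᶜ ⊓ (a ⊔ b ⊔ c ⊔ d) ≠ ⊥ := by
    rcases hx2 with h | h
    · obtain ⟨h1, h2⟩ := hc' h
      clear * - h1 hc
      simp only [le_iff_mem, eq_bot_iff_mem, eq_top_iff_mem, mem_bot, mem_top, mem_sup, mem_inf,
        mem_compl, mem_sdiff, ne_eq] at *
      grind
    · obtain ⟨h1, h2⟩ := hd' h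
      clear * - h1 hd
      simp only [le_iff_mem, eq_bot_iff_mem, eq_top_iff_mem, mem_bot, mem_top, mem_sup, mem_inf,
        mem_compl, mem_sdiff, ne_eq] at *
      grind
  have key4 : x.1ᶜ ⊓ (a ⊔ b ⊔ c ⊔ d)ᶜ ≠ ⊥ := by
    rcases hx2 with h | h
    · obtain ⟨h1, h2⟩ := hc' h
      clear * - h2 ha hb hc hd
      simp only [le_iff_mem, eq_bot_iff_mem, eq_top_iff_mem, mem_bot, mem_top, mem_sup, mem_inf,
        mem_compl, mem_sdiff, ne_eq] at *
      grind
    · obtain ⟨h1, h2⟩ := hd' h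
      clear * - h2 ha hb hc hd
      simp only [le_iff_mem, eq_bot_iff_mem, eq_top_iff_mem, mem_bot, mem_top, mem_sup, mem_inf,
        mem_compl, mem_sdiff, ne_eq] at *
      grind
  have key5 : (a ⊔ b ⊔ c ⊔ d) ⊓ y.1 ≠ ⊥ := by
    rcases hy1 with h | h
    · obtain ⟨h1, h2⟩ := ha' h
      clear * - h1 ha
      simp only [le_iff_mem, eq_bot_iff_mem, eq_top_iff_mem, mem_bot, mem_top, mem_sup, mem_inf,
        mem_compl, mem_sdiff, ne_eq] at *
      grind
    · obtain ⟨h1, h2⟩ := hc' h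
      clear * - h1 hc
      simp only [le_iff_mem, eq_bot_iff_mem, eq_top_iff_mem, mem_bot, mem_top, mem_sup, mem_inf,
        mem_compl, mem_sdiff, ne_eq] at *
      grind
  have key6 : (a ⊔ b ⊔ c ⊔ d)ᶜ ⊓ y.1 ≠ ⊥ := by
    rcases hy1 with h | h
    · obtain ⟨h1, h2⟩ := ha' h
      clear * - h2 ha hb hc hd
      simp only [le_iff_mem, eq_bot_iff_mem, eq_top_iff_mem, mem_bot, mem_top, mem_sup, mem_inf,
        mem_compl, mem_sdiff, ne_eq] at *
      grind
    · obtain ⟨h1, h2⟩ := hc' h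
      clear * - h2 ha hb hc hd
      simp only [le_iff_mem, eq_bot_iff_mem, eq_top_iff_mem, mem_bot, mem_top, mem_sup, mem_inf,
        mem_compl, mem_sdiff, ne_eq] at *
      grind
  have key7 : (a ⊔ b ⊔ c ⊔ d) ⊓ y.1ᶜ ≠ ⊥ := by
    rcases hy2 with h | h
    · obtain ⟨h1, h2⟩ := hb' h
      clear * - h1 hb
      simp only [le_iff_mem, eq_bot_iff_mem, eq_top_iff_mem, mem_bot, mem_top, mem_sup, mem_inf,
        mem_compl, mem_sdiff, ne_eq] at *
      grind
    · obtain ⟨h1, h2⟩ := hd' h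
      clear * - h1 hd
      simp only [le_iff_mem, eq_bot_iff_mem, eq_top_iff_mem, mem_bot, mem_top, mem_sup, mem_inf,
        mem_compl, mem_sdiff, ne_eq] at *
      grind
  have key8 : (a ⊔ b ⊔ c ⊔ d)ᶜ ⊓ y.1ᶜ ≠ ⊥ := by
    rcases hy2 with h | h
    · obtain ⟨h1, h2⟩ := hb' h
      clear * - h2 ha hb hc hd
      simp only [le_iff_mem, eq_bot_iff_mem, eq_top_iff_mem, mem_bot, mem_top, mem_sup, mem_inf,
        mem_compl, mem_sdiff, ne_eq] at *
      grind
    · obtain ⟨h1, h2⟩ := hd' h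
      clear * - h2 ha hb hc hd
      simp only [le_iff_mem, eq_bot_iff_mem, eq_top_iff_mem, mem_bot, mem_top, mem_sup, mem_inf,
        mem_compl, mem_sdiff, ne_eq] at *
      grind
  refine ⟨⟨a ⊔ b ⊔ c ⊔ d, fun h => key1 ?_, fun h => key2 ?_⟩, ⟨key1, key2, key3, key4⟩,
    key5, key7, key6, key8⟩ <;> simp [h]

/-- The relations for which both `xᶜ ⊓ y` and `xᶜ ⊓ yᶜ` are nonzero. -/
def splitsCompl : RCC11 → Bool
  | .TPP | .NTPP | .PON | .ECN | .DC => true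
  | _ => false

theorem Holds.splitsCompl_iff {x y : Region A} (h : M.Holds Q x.1 y.1) :
    splitsCompl Q ↔ x.1ᶜ ⊓ y.1 ≠ ⊥ ∧ x.1ᶜ ⊓ y.1ᶜ ≠ ⊥ := by
  have hx := x.2
  have hy := y.2
  have h1 : x.1 ⊓ y.1 = ⊥ → x.1ᶜ ⊓ y.1 ≠ ⊥ := by
    clear h
    intro h h'
    simp only [le_iff_mem, eq_bot_iff_mem, eq_top_iff_mem, mem_bot, mem_top, mem_sup, mem_inf,
      mem_compl, mem_sdiff, ne_eq] at *
    grind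
  have h2 : x.1 ⊓ y.1ᶜ = ⊥ → x.1ᶜ ⊓ y.1ᶜ ≠ ⊥ := by
    clear h
    intro h h'
    simp only [le_iff_mem, eq_bot_iff_mem, eq_top_iff_mem, mem_bot, mem_top, mem_sup, mem_inf,
      mem_compl, mem_sdiff, ne_eq] at *
    grind
  cases Q <;> simp only [Holds] at h <;> simp [splitsCompl, h] <;>
    first | exact h1 h.1 | exact h2 h.1

/-- Remove from `xᶜ` pieces `a`, `b` well inside `xᶜ ⊓ y` and `xᶜ ⊓ yᶜ`. They do not touch `x`, so
what remains does. -/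
theorem exists_ECN_PON {x y : Region A} (h : x.1ᶜ ⊓ y.1 ≠ ⊥) (h' : x.1ᶜ ⊓ y.1ᶜ ≠ ⊥) :
    ∃ z : Region A, M.Holds .ECN x.1 z.1 ∧ M.Holds .PON z.1 y.1 := by
  obtain ⟨a, ha, ha1, ha2, haC⟩ := M.exists_lt_not_C h
  obtain ⟨b, hb, hb1, hb2, hbC⟩ := M.exists_lt_not_C h'
  have hx := x.2
  have hC : (x.1, x.1ᶜ \ (a ⊔ b)) ∈ M.C := by
    refine C_of_le_sup (M.compl _ x.2.1 x.2.2) (fun hC => ?_) le_sup_sdiff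
    rcases M.C_sup.1 hC with h1 | h1
    · refine haC (C_mono (M.C_comm.1 h1) le_rfl ?_)
      clear * -
      simp only [le_iff_mem, eq_bot_iff_mem, eq_top_iff_mem, mem_bot, mem_top, mem_sup, mem_inf,
        mem_compl, mem_sdiff, ne_eq] at *
      grind
    · refine hbC (C_mono (M.C_comm.1 h1) le_rfl ?_)
      clear * -
      simp only [le_iff_mem, eq_bot_iff_mem, eq_top_iff_mem, mem_bot, mem_top, mem_sup, mem_inf,
        mem_compl, mem_sdiff, ne_eq] at *
      grind
  clear haC hbC
  refine ⟨⟨x.1ᶜ \ (a ⊔ b), (M.ne_bot _ _ hC).2, ?_⟩, ⟨?_, ?_, hC⟩, ?_, ?_, ?_, ?_⟩ <;>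
    (try dsimp only) <;> clear hC <;>
    simp only [le_iff_mem, eq_bot_iff_mem, eq_top_iff_mem, mem_bot, mem_top, mem_sup, mem_inf,
      mem_compl, mem_sdiff, ne_eq] at * <;> grind

/-- Here `z` consists of two such pieces, which are away from `x`. -/
theorem exists_DC_PON {x y : Region A} (h : x.1ᶜ ⊓ y.1 ≠ ⊥) (h' : x.1ᶜ ⊓ y.1ᶜ ≠ ⊥) :
    ∃ z : Region A, M.Holds .DC x.1 z.1 ∧ M.Holds .PON z.1 y.1 := by
  obtain ⟨a, ha, ha1, ha2, haC⟩ := M.exists_lt_not_C h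
  obtain ⟨b, hb, hb1, hb2, hbC⟩ := M.exists_lt_not_C h'
  have hx := x.2
  have hC : (x.1, a ⊔ b) ∉ M.C := by
    intro hC
    rcases M.C_sup.1 hC with h1 | h1
    · refine haC (C_mono (M.C_comm.1 h1) le_rfl ?_)
      clear * -
      simp only [le_iff_mem, eq_bot_iff_mem, eq_top_iff_mem, mem_bot, mem_top, mem_sup, mem_inf,
        mem_compl, mem_sdiff, ne_eq] at *
      grind
    · refine hbC (C_mono (M.C_comm.1 h1) le_rfl ?_)
      clear * -
      simp only [le_iff_mem, eq_bot_iff_mem, eq_top_iff_mem, mem_bot, mem_top, mem_sup, mem_inf,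
        mem_compl, mem_sdiff, ne_eq] at *
      grind
  clear haC hbC
  refine ⟨⟨a ⊔ b, ?_, ?_⟩, ⟨?_, ?_, hC⟩, ?_, ?_, ?_, ?_⟩ <;>
    (try dsimp only) <;> clear hC <;>
    simp only [le_iff_mem, eq_bot_iff_mem, eq_top_iff_mem, mem_bot, mem_top, mem_sup, mem_inf,
      mem_compl, mem_sdiff, ne_eq] at * <;> grind

/-- A region disjoint from `x` and `PON` to `y` forces `xᶜ` to meet both `y` and `yᶜ`; by `hex` this
necessary condition is sufficient. -/
theorem correctCell_PON_of_le_compl (hRQ : ∀ Q, IsTriad R Q .PON ↔ splitsCompl Q)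
    (hRQ' : ∀ Q, IsPlain R Q .PON ↔ splitsCompl Q)
    (hR : ∀ {x z : A}, M.Holds R x z → x ⊓ z = ⊥)
    (hex : ∀ {x y : Region A}, x.1ᶜ ⊓ y.1 ≠ ⊥ → x.1ᶜ ⊓ y.1ᶜ ≠ ⊥ →
      ∃ z : Region A, M.Holds R x.1 z.1 ∧ M.Holds .PON z.1 y.1) : M.CorrectCell R .PON := by
  intro Q
  by_cases hQ : splitsCompl Q
  · refine correct_of_extensional (fun x y h => ?_) ((hRQ' Q).2 hQ)
    obtain ⟨h1, h2⟩ := h.splitsCompl_iff.1 hQ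
    exact hex h1 h2
  · refine correct_of_not_consistent ?_ (fun h => hQ ((hRQ Q).1 h))
    rintro ⟨x, y, z, h1, h2, h3, h4, -⟩
    refine hQ (h1.splitsCompl_iff.2 ?_)
    have := hR h2
    clear * - h3 h4 this
    simp only [le_iff_mem, eq_bot_iff_mem, eq_top_iff_mem, mem_bot, mem_top, mem_sup, mem_inf,
      mem_compl, mem_sdiff, ne_eq] at *
    grind

theorem correctCell_ECN_PON : M.CorrectCell .ECN .PON :=
  correctCell_PON_of_le_compl (by decide) (by decide) (fun h => h.1) exists_ECN_PON

theorem correctCell_DC_PON : M.CorrectCell .DC .PON :=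
  correctCell_PON_of_le_compl (by decide) (by decide) (fun h => h.1) exists_DC_PON

/-! ### The cells of `DC` -/

theorem holds_DC {x y : Region A} : M.Holds .DC x.1 y.1 ↔ (x.1, y.1) ∉ M.C := by
  rw [← mem_rel]
  rfl

theorem holds_NTPP {x y : Region A} : M.Holds .NTPP x.1 y.1 ↔ (x.1, y.1ᶜ) ∉ M.C := by
  rw [← mem_rel]
  exact mem_NTPP

theorem holds_NTPPi {x y : Region A} : M.Holds .NTPPi x.1 y.1 ↔ (x.1ᶜ, y.1) ∉ M.C := by
  rw [M.C_comm]
  exact (holds_conv .NTPP x.1 y.1).trans holds_NTPP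

theorem Holds.compl_inf_compl_ne_bot_iff {x y : Region A} (h : M.Holds Q x.1 y.1) :
    x.1ᶜ ⊓ y.1ᶜ ≠ ⊥ ↔ Q ≠ .PODY ∧ Q ≠ .PODZ ∧ Q ≠ .ECD := by
  have hx := x.2
  have hy := y.2
  have h1 : x.1 ⊓ y.1ᶜ = ⊥ → x.1ᶜ ⊓ y.1ᶜ ≠ ⊥ := by
    clear h
    intro h h'
    simp only [le_iff_mem, eq_bot_iff_mem, eq_top_iff_mem, mem_bot, mem_top, mem_sup, mem_inf,
      mem_compl, mem_sdiff, ne_eq] at *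
    grind
  have h2 : x.1ᶜ ⊓ y.1 = ⊥ → x.1ᶜ ⊓ y.1ᶜ ≠ ⊥ := by
    clear h
    intro h h'
    simp only [le_iff_mem, eq_bot_iff_mem, eq_top_iff_mem, mem_bot, mem_top, mem_sup, mem_inf,
      mem_compl, mem_sdiff, ne_eq] at *
    grind
  cases Q <;> simp only [Holds] at h <;> simp [h] <;> first | exact h1 h.1 | exact h2 h.1

/-- A region away from both `x` and `y` is one away from `x ⊔ y`, and exists exactly when `x ⊔ y ≠
⊤`. -/
theorem correctCell_DC_DC : M.CorrectCell .DC .DC := by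
  intro Q
  by_cases hQ : Q ≠ .PODY ∧ Q ≠ .PODZ ∧ Q ≠ .ECD
  · refine correct_of_extensional (fun x y h => ?_) (by revert Q; decide)
    obtain ⟨z, h1, h2, -, h3⟩ := exists_DC (M := M) (a := x.1 ⊔ y.1) (by
      rw [ne_eq, ← compl_inf_compl_eq_bot_iff]
      exact h.compl_inf_compl_ne_bot_iff.2 hQ)
    refine ⟨⟨z, h1, fun hz => ?_⟩, holds_DC.2 fun hC => h3 ?_, holds_DC.2 fun hC => h3 ?_⟩
    · have hx := x.2
      clear * - hx h2 hz
      simp only [le_iff_mem, eq_bot_iff_mem, eq_top_iff_mem, mem_bot, mem_top, mem_sup, mem_inf,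
        mem_compl, mem_sdiff, ne_eq] at *
      grind
    · exact C_mono_right (M.C_comm.1 hC) le_sup_left
    · exact C_mono_right hC le_sup_right
  · refine correct_of_not_consistent ?_ (by revert Q; decide)
    rintro ⟨x, y, z, h1, h2, h3⟩
    refine hQ (h1.compl_inf_compl_ne_bot_iff.1 ?_)
    have h4 := h2.1
    have h5 := h3.1
    have hz := z.2.1
    clear * - h4 h5 hz
    simp only [le_iff_mem, eq_bot_iff_mem, eq_top_iff_mem, mem_bot, mem_top, mem_sup, mem_inf,
      mem_compl, mem_sdiff, ne_eq] at *
    grind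

/-- Correctness of a cell whose only entry is `DC`. -/
theorem correctCell_of_DC (hT : ∀ Q, IsTriad R Q S ↔ Q = .DC) (hP : IsPlain R .DC S)
    (h : ∀ x y z : Region A, M.Holds R x.1 z.1 → M.Holds S z.1 y.1 → (x.1, y.1) ∉ M.C)
    (hex : ∀ x y : Region A, (x.1, y.1) ∉ M.C →
      ∃ z : Region A, M.Holds R x.1 z.1 ∧ M.Holds S z.1 y.1) : M.CorrectCell R S := by
  intro Q
  by_cases hQ : Q = .DC
  · subst hQ
    exact correct_of_extensional (fun x y h => hex x y (holds_DC.1 h)) hP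
  · refine correct_of_not_consistent ?_ (fun h => hQ ((hT Q).1 h))
    rintro ⟨x, y, z, h1, h2, h3⟩
    exact hQ (h1.unique (holds_DC.2 (h x y z h2 h3)))

/-- Interpolation between two regions which are not in contact. -/
theorem IsStrong.exists_separation (hM : M.IsStrong) {x y : Region A} (h : (x.1, y.1) ∉ M.C) :
    ∃ w : Region A, (x.1, w.1ᶜ) ∉ M.C ∧ (w.1, y.1) ∉ M.C := by
  obtain ⟨w, h1, h2⟩ := hM.exists_between (x := x) (y := regionCompl y) (by
    simpa only [regionCompl, compl_compl])
  exact ⟨w, h1, by simpa only [regionCompl, compl_compl] using h2⟩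

theorem correctCell_DC_NTPPi (hM : M.IsStrong) : M.CorrectCell .DC .NTPPi := by
  refine correctCell_of_DC (by decide) (by decide) (fun x y z h1 h2 => ?_) (fun x y h => ?_)
  · exact fun h => h1.2.2 (C_mono_right h (compl_inf_eq_bot_iff.1 h2.1))
  · obtain ⟨w, h1, h2⟩ := hM.exists_separation h
    refine ⟨regionCompl w, holds_DC.2 h1, holds_NTPPi.2 ?_⟩
    simpa only [regionCompl, compl_compl]

/-! ### The cells of `ECN` -/

/-- The obvious choice `z = xᶜ` would be `ECD` to `x`. Strength provides a neighbourhood `w` of `y`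
away from `x`, and a piece `m` of `xᶜ` outside `w` can be removed. -/
theorem correctCell_ECN_NTPPi (hM : M.IsStrong) : M.CorrectCell .ECN .NTPPi := by
  refine correctCell_of_DC (by decide) (by decide) (fun x y z h1 h2 => ?_) (fun x y h => ?_)
  · refine fun h => h2.2.2 (C_mono h ?_ le_rfl)
    exact inf_compl_eq_bot_iff.1 (by rw [compl_compl]; exact h1.1)
  · obtain ⟨w, h1, h2⟩ := hM.exists_separation (fun h' => h (M.C_comm.1 h'))
    obtain ⟨m, hm, hm1, hm2, hmC⟩ := M.exists_lt_not_C (a := x.1ᶜ \ w.1) (by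
      rw [ne_eq, sdiff_eq_bot_iff]
      exact not_le_of_not_C w.2 (by rwa [compl_compl]))
    have hC : (x.1, x.1ᶜ \ m) ∈ M.C := by
      refine C_of_le_sup (M.compl _ x.2.1 x.2.2) (fun hC => ?_) le_sup_sdiff
      refine hmC (C_mono (M.C_comm.1 hC) le_rfl ?_)
      clear * -
      simp only [le_iff_mem, eq_bot_iff_mem, eq_top_iff_mem, mem_bot, mem_top, mem_sup, mem_inf,
        mem_compl, mem_sdiff, ne_eq] at *
      grind
    have hz : x.1ᶜ \ m ≠ ⊥ ∧ x.1ᶜ \ m ≠ ⊤ := by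
      refine ⟨(M.ne_bot _ _ hC).2, fun hz => ?_⟩
      have hx := x.2
      clear * - hz hx
      simp only [le_iff_mem, eq_bot_iff_mem, eq_top_iff_mem, mem_bot, mem_top, mem_sup, mem_inf,
        mem_compl, mem_sdiff, ne_eq] at *
      grind
    refine ⟨⟨_, hz⟩, ⟨?_, ?_, hC⟩, holds_NTPPi.2 fun h' => h1 ?_⟩
    · exact disjoint_iff.1 (disjoint_compl_right.mono_right sdiff_le)
    · clear * - hm hm1
      simp only [le_iff_mem, eq_bot_iff_mem, eq_top_iff_mem, mem_bot, mem_top, mem_sup, mem_inf,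
        mem_compl, mem_sdiff, ne_eq] at *
      grind
    · refine C_mono (M.C_comm.1 h') le_rfl ?_
      have h3 := le_compl_of_not_C h2
      clear * - hm1 h3
      simp only [le_iff_mem, eq_bot_iff_mem, eq_top_iff_mem, mem_bot, mem_top, mem_sup, mem_inf,
        mem_compl, mem_sdiff, ne_eq] at *
      grind

theorem correctCell_ECN_TPPi (hM : M.IsStrong) : M.CorrectCell .ECN .TPPi := by
  intro Q
  by_cases h1 : Q = .ECN
  · subst h1
    refine correct_of_extensional (fun x y h => ?_) (by decide)
    obtain ⟨h1, h2, h3⟩ := h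
    obtain ⟨m, hm, hm1, hm2, -⟩ := M.exists_lt_not_C h2
    have hx := x.2
    have hy := y.2
    -- Enlarging `y` by a proper part `m` of the free atom makes it a proper part of `z`; it stays
    -- tangential because it touches `x ≤ zᶜ`.
    refine ⟨⟨y.1 ⊔ m, ?_, ?_⟩, ⟨?_, ?_, C_mono_right h3 le_sup_left⟩, ?_, ?_, C_mono h3 ?_ le_rfl⟩ <;>
      (try dsimp only) <;> clear h3 <;>
      simp only [le_iff_mem, eq_bot_iff_mem, eq_top_iff_mem, mem_bot, mem_top, mem_sup, mem_inf,
        mem_compl, mem_sdiff, ne_eq] at * <;> grind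
  by_cases h2 : Q = .DC
  · subst h2
    refine correct_of_extensional (fun x y h => ?_) (by decide)
    replace h := holds_DC.1 h
    obtain ⟨w, h1, h2⟩ := hM.exists_separation (fun h' => h (M.C_comm.1 h'))
    have h3 : (x.1, x.1ᶜ \ w.1) ∈ M.C :=
      C_of_le_sup (M.compl _ x.2.1 x.2.2) (fun h => h2 (M.C_comm.1 h)) le_sup_sdiff
    have h4 : (y.1, w.1 \ y.1) ∈ M.C := C_sdiff y.2 h1
    have h5 := (M.ne_bot _ _ h3).2
    have h6 := (M.ne_bot _ _ h4).2
    have h7 := le_of_not_C h1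
    have h8 := le_compl_of_not_C h2
    have hy := y.2
    -- The gap `w \ y` left out of `z` keeps `y` tangential in `z` and `x ⊔ z` below `⊤`, while `xᶜ
    -- \ w` touches `x`.
    refine ⟨⟨y.1 ⊔ x.1ᶜ \ w.1, ?_, ?_⟩, ⟨?_, ?_, C_mono_right h3 le_sup_right⟩, ?_, ?_,
      C_mono (M.C_comm.1 h4) ?_ le_rfl⟩ <;>
      (try dsimp only) <;> clear h h1 h2 h3 h4 <;>
      simp only [le_iff_mem, eq_bot_iff_mem, eq_top_iff_mem, mem_bot, mem_top, mem_sup, mem_inf,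
        mem_compl, mem_sdiff, ne_eq] at * <;> grind
  · refine correct_of_not_consistent ?_ (by revert Q; decide)
    rintro ⟨x, y, z, h3, h4, h5⟩
    have h6 : x.1 ⊓ y.1 = ⊥ := by
      have h1 := h4.1
      have h2 := h5.1
      clear * - h1 h2
      simp only [le_iff_mem, eq_bot_iff_mem, eq_top_iff_mem, mem_bot, mem_top, mem_sup, mem_inf,
        mem_compl, mem_sdiff, ne_eq] at *
      grind
    have h7 : x.1ᶜ ⊓ y.1ᶜ ≠ ⊥ := by
      have h1 := h5.1
      have h2 := h4.2.1
      clear * - h1 h2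
      simp only [le_iff_mem, eq_bot_iff_mem, eq_top_iff_mem, mem_bot, mem_top, mem_sup, mem_inf,
        mem_compl, mem_sdiff, ne_eq] at *
      grind
    by_cases hC : (x.1, y.1) ∈ M.C
    · exact h1 (h3.unique (S := .ECN) ⟨h6, h7, hC⟩)
    · exact h2 (h3.unique (holds_DC.2 hC))

theorem not_consistent_of_compl_le {x y z : Region A} (h : x.1ᶜ ⊓ y.1ᶜ = ⊥)
    (h1 : x.1 ⊓ z.1 = ⊥) (h2 : z.1 ⊓ y.1 = ⊥) : False := by
  have hz := z.2.1
  simp only [le_iff_mem, eq_bot_iff_mem, eq_top_iff_mem, mem_bot, mem_top, mem_sup, mem_inf,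
    mem_compl, mem_sdiff, ne_eq] at *
  grind

/-! ### Marked entries: counterexamples to extensionality -/

/-- A region, a region well inside it, and a proper part of the latter. -/
theorem exists_chain (M : RCCModel A) : ∃ w m n : Region A,
    (m.1, w.1ᶜ) ∉ M.C ∧ n.1 ≤ m.1 ∧ m.1 ≤ w.1 ∧ w.1 \ m.1 ≠ ⊥ ∧
      m.1 \ n.1 ≠ ⊥ := by
  obtain ⟨w⟩ := M.exists_region
  obtain ⟨m, hm, hm1, hm2, hmC⟩ := M.exists_lt_not_C w.2.1
  obtain ⟨n, hn, hn1, hn2, -⟩ := M.exists_lt_not_C hm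
  have hmT : m ≠ ⊤ := fun h => w.2.2 (top_le_iff.1 (h.ge.trans hm1))
  have hnT : n ≠ ⊤ := fun h => hmT (top_le_iff.1 (h.ge.trans hn1))
  exact ⟨w, ⟨m, hm, hmT⟩, ⟨n, hn, hnT⟩, hmC, hn1, hm1, hm2, hn2⟩

/-- For the pair `m`, `w \ n` the join is `w`, so a `z` disjoint from both lies in `wᶜ`, which `m`
does not touch. -/
theorem not_extensional_ECN_PON_ECN (M : RCCModel A) : ¬M.Extensional .ECN .PON .ECN := by
  obtain ⟨w, m, n, h1, h2, h3, h4, h5⟩ := M.exists_chain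
  have hw := w.2
  have hn := n.2
  intro h
  have hy : w.1 \ n.1 ≠ ⊥ ∧ w.1 \ n.1 ≠ ⊤ := by
    clear h h1
    constructor <;>
      simp only [le_iff_mem, eq_bot_iff_mem, eq_top_iff_mem, mem_bot, mem_top, mem_sup, mem_inf,
        mem_compl, mem_sdiff, ne_eq] at * <;> grind
  obtain ⟨z, h6, h7⟩ := h m ⟨_, hy⟩ (by
    clear h h1
    refine ⟨?_, ?_, ?_, ?_⟩ <;> (try dsimp only) <;>
      simp only [le_iff_mem, eq_bot_iff_mem, eq_top_iff_mem, mem_bot, mem_top, mem_sup, mem_inf,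
        mem_compl, mem_sdiff, ne_eq] at * <;> grind)
  refine h1 (C_mono_right h6.2.2 ?_)
  have h8 := h6.1
  have h9 := h7.1
  dsimp only at h9
  clear * - h2 h8 h9
  simp only [le_iff_mem, eq_bot_iff_mem, eq_top_iff_mem, mem_bot, mem_top, mem_sup, mem_inf,
    mem_compl, mem_sdiff, ne_eq] at *
  grind

theorem holds_ECN_chain {w m : Region A} (h : (m.1, w.1ᶜ) ∉ M.C) :
    ∃ y : Region A, y.1 = w.1 \ m.1 ∧ M.Holds .ECN m.1 y.1 := by
  have hC := C_sdiff m.2 h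
  have hle := le_of_not_C h
  have hw := w.2
  refine ⟨⟨_, (M.ne_bot _ _ hC).2, ?_⟩, rfl, ?_, ?_, hC⟩ <;> (try dsimp only) <;> clear hC h <;>
    simp only [le_iff_mem, eq_bot_iff_mem, eq_top_iff_mem, mem_bot, mem_top, mem_sup, mem_inf,
      mem_compl, mem_sdiff, ne_eq] at * <;> grind

/-- If `y = w \ m` is the collar of `m` in `w`, then a `z` disjoint from `m` and `y` lies in `wᶜ`,
out of reach of `m`. -/
theorem not_extensional_ECN_ECN (M : RCCModel A)
    (hS : ∀ z y : A, M.Holds S z y → z ⊓ y = ⊥) : ¬M.Extensional .ECN .ECN S := by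
  obtain ⟨w, m, -, h1, -⟩ := M.exists_chain
  obtain ⟨y, hy, h2⟩ := holds_ECN_chain h1
  intro h
  obtain ⟨z, h3, h4⟩ := h m y h2
  refine h1 (C_mono_right h3.2.2 ?_)
  have h5 := h3.1
  have h6 := hS _ _ h4
  rw [hy] at h6
  clear * - h5 h6
  simp only [le_iff_mem, eq_bot_iff_mem, eq_top_iff_mem, mem_bot, mem_top, mem_sup, mem_inf,
    mem_compl, mem_sdiff, ne_eq] at *
  grind

/-- Split each of the disjoint regions `n`, `m \ n`, `w \ m` into two touching parts and join parts
of different regions cyclically: the three joins are disjoint and touch pairwise, all inside `w ≠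
⊤`. -/
theorem consistent_ECN_ECN_ECN (M : RCCModel A) : M.Consistent .ECN .ECN .ECN := by
  obtain ⟨w, m, n, -, h1, h2, h3, h4⟩ := M.exists_chain
  have key {p : A} (hp : p ≠ ⊥) (hpT : p ≠ ⊤) : ∃ a b, a ⊔ b ≤ p ∧ a ⊓ b = ⊥ ∧ (a, b) ∈ M.C := by
    obtain ⟨a, ha, ha1, -, haC⟩ := M.exists_lt_not_C hp
    exact ⟨a, p \ a, sup_le ha1 sdiff_le, inf_sdiff_self_right,
      C_sdiff ⟨ha, fun h => hpT (top_le_iff.1 (h.ge.trans ha1))⟩ haC⟩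
  obtain ⟨a, b, h5, h6, h7⟩ := key n.2.1 n.2.2
  obtain ⟨c, d, h8, h9, h10⟩ := key h4 (fun h => m.2.2 (top_le_iff.1 (h.ge.trans sdiff_le)))
  obtain ⟨e, f, h11, h12, h13⟩ := key h3 (fun h => w.2.2 (top_le_iff.1 (h.ge.trans sdiff_le)))
  have h14 := (M.ne_bot _ _ h7).2
  have h15 := (M.ne_bot _ _ h10).2
  have h16 := (M.ne_bot _ _ h13).2
  have hw := w.2.2
  have hd1 : (a ⊔ f) ⊓ (b ⊔ c) = ⊥ := by
    clear * - h1 h2 h5 h8 h11 h6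
    simp only [le_iff_mem, eq_bot_iff_mem, eq_top_iff_mem, mem_bot, mem_top, mem_sup, mem_inf,
      mem_compl, mem_sdiff, ne_eq] at *
    grind
  have hd2 : (a ⊔ f) ⊓ (d ⊔ e) = ⊥ := by
    clear * - h1 h2 h5 h8 h11 h12
    simp only [le_iff_mem, eq_bot_iff_mem, eq_top_iff_mem, mem_bot, mem_top, mem_sup, mem_inf,
      mem_compl, mem_sdiff, ne_eq] at *
    grind
  have hd3 : (d ⊔ e) ⊓ (b ⊔ c) = ⊥ := by
    clear * - h1 h2 h5 h8 h11 h9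
    simp only [le_iff_mem, eq_bot_iff_mem, eq_top_iff_mem, mem_bot, mem_top, mem_sup, mem_inf,
      mem_compl, mem_sdiff, ne_eq] at *
    grind
  have hn1 : (a ⊔ f) ⊔ (b ⊔ c) ⊔ (d ⊔ e) ≤ w.1 := by
    clear * - h1 h2 h5 h8 h11
    simp only [le_iff_mem, eq_bot_iff_mem, eq_top_iff_mem, mem_bot, mem_top, mem_sup, mem_inf,
      mem_compl, mem_sdiff, ne_eq] at *
    grind
  have c1 : (a ⊔ f, b ⊔ c) ∈ M.C := C_mono h7 le_sup_left le_sup_left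
  have c2 : (a ⊔ f, d ⊔ e) ∈ M.C := C_mono (M.C_comm.1 h13) le_sup_right le_sup_right
  have c3 : (d ⊔ e, b ⊔ c) ∈ M.C := C_mono (M.C_comm.1 h10) le_sup_left le_sup_right
  have b1 := M.ne_bot _ _ c1
  have b2 := M.ne_bot _ _ c2
  clear * - hd1 hd2 hd3 hn1 hw c1 c2 c3 b1 b2
  generalize a ⊔ f = x at *
  generalize b ⊔ c = y at *
  generalize d ⊔ e = z at *
  refine ⟨⟨x, b1.1, ?_⟩, ⟨y, b1.2, ?_⟩, ⟨z, b2.2, ?_⟩, ⟨hd1, ?_, c1⟩, ⟨hd2, ?_, c2⟩, hd3, ?_, c3⟩ <;>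
    (try dsimp only) <;> clear c1 c2 c3 <;>
    simp only [le_iff_mem, eq_bot_iff_mem, eq_top_iff_mem, mem_bot, mem_top, mem_sup, mem_inf,
      mem_compl, mem_sdiff, ne_eq] at * <;> grind

/-- A `z` externally connected to `w` cannot touch the deep part `e`, so it touches `y`, which
covers the rest of `w`. -/
theorem not_extensional_ECN_DC {w e y : Region A} (he : (e.1, w.1ᶜ) ∉ M.C)
    (hy : w.1 ≤ e.1 ⊔ y.1) (hQ : M.Holds Q w.1 y.1) : ¬M.Extensional .ECN Q .DC := by
  intro h
  obtain ⟨z, h1, h2⟩ := h w y hQ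
  refine h2.2.2 (C_of_le_sup (M.C_comm.1 h1.2.2) (fun hC => he ?_) hy)
  refine C_mono (M.C_comm.1 hC) le_rfl ?_
  rw [← inf_compl_eq_bot_iff, compl_compl, inf_comm]
  exact h1.1

theorem not_extensional_ECN_TPPi_DC (M : RCCModel A) : ¬M.Extensional .ECN .TPPi .DC := by
  obtain ⟨w, m, -, h1, -, h2, h3, -⟩ := M.exists_chain
  have hw := w.2
  have hm := m.2
  have hC : (w.1ᶜ, w.1 \ m.1) ∈ M.C :=
    C_of_le_sup (M.C_comm.1 (M.compl _ w.2.1 w.2.2)) (fun h => h1 (M.C_comm.1 h)) le_sup_sdiff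
  have hy : w.1 \ m.1 ≠ ⊤ := fun h => w.2.2 (top_le_iff.1 (h.ge.trans sdiff_le))
  refine not_extensional_ECN_DC (y := ⟨w.1 \ m.1, h3, hy⟩) h1 le_sup_sdiff ⟨?_, ?_, hC⟩ <;>
    dsimp only <;> clear h1 hC <;>
    simp only [le_iff_mem, eq_bot_iff_mem, eq_top_iff_mem, mem_bot, mem_top, mem_sup, mem_inf,
      mem_compl, mem_sdiff, ne_eq] at * <;> grind

theorem not_extensional_ECN_PON_DC (M : RCCModel A) : ¬M.Extensional .ECN .PON .DC := by
  obtain ⟨w, m, -, h1, -, h2, h3, -⟩ := M.exists_chain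
  obtain ⟨f, hf, hf1, hf2, -⟩ := M.exists_lt_not_C (compl_region w).1
  have hm := m.2
  have hy : w.1 \ m.1 ⊔ f ≠ ⊥ ∧ w.1 \ m.1 ⊔ f ≠ ⊤ := by
    clear h1
    constructor <;>
      simp only [le_iff_mem, eq_bot_iff_mem, eq_top_iff_mem, mem_bot, mem_top, mem_sup, mem_inf,
        mem_compl, mem_sdiff, ne_eq] at * <;> grind
  refine not_extensional_ECN_DC (y := ⟨_, hy⟩) h1 ?_ ⟨?_, ?_, ?_, ?_⟩ <;>
    dsimp only <;> clear h1 <;>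
    simp only [le_iff_mem, eq_bot_iff_mem, eq_top_iff_mem, mem_bot, mem_top, mem_sup, mem_inf,
      mem_compl, mem_sdiff, ne_eq] at * <;> grind

theorem correctCell_ECN_ECN : M.CorrectCell .ECN .ECN := by
  intro Q
  have h1 {x y : Region A} (h : x.1 ⊓ y.1ᶜ = ⊥) (hC : (x.1, y.1ᶜ) ∈ M.C) :
      ∃ z : Region A, M.Holds .ECN y.1 z.1 ∧ M.Holds .ECN z.1 x.1 := by
    obtain ⟨z, h1, h2⟩ := exists_ECN_left_ECN h hC
    exact ⟨z, (holds_conv .ECN _ _).1 h2, (holds_conv .ECN _ _).1 h1⟩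
  have h2 {x y : Region A} (h : x.1ᶜ ⊓ y.1ᶜ = ⊥) :
      ¬∃ z : Region A, M.Holds .ECN x.1 z.1 ∧ M.Holds .ECN z.1 y.1 :=
    fun ⟨z, h1, h2⟩ => not_consistent_of_compl_le h h1.1 h2.1
  cases Q
  case one =>
    refine correct_of_extensional (fun x y h => exists_ECN_left_ECN h.1 ?_) (by decide)
    exact C_mono_right (M.compl _ x.2.1 x.2.2) (compl_le_compl (compl_inf_eq_bot_iff.1 h.2))
  case TPP => exact correct_of_extensional (fun x y h => exists_ECN_left_ECN h.1 h.2.2) (by decide)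
  case TPPi =>
    refine correct_of_extensional (fun x y h => h1 ?_ (M.C_comm.1 h.2.2)) (by decide)
    rw [inf_comm]
    exact h.1
  case DC =>
    refine correct_of_extensional (fun x y h => ?_) (by decide)
    obtain ⟨h1, h2, h3⟩ := h
    -- The witness is everything outside both: each region touches its complement but not the other
    -- region, hence touches `xᶜ ⊓ yᶜ`.
    have h4 : (x.1, x.1ᶜ ⊓ y.1ᶜ) ∈ M.C := by
      refine C_of_le_sup (M.compl _ x.2.1 x.2.2) h3 ?_
      clear * -
      simp only [le_iff_mem, eq_bot_iff_mem, eq_top_iff_mem, mem_bot, mem_top, mem_sup, mem_inf,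
        mem_compl, mem_sdiff, ne_eq] at *
      grind
    have h5 : (y.1, x.1ᶜ ⊓ y.1ᶜ) ∈ M.C := by
      refine C_of_le_sup (M.compl _ y.2.1 y.2.2) (fun h => h3 (M.C_comm.1 h)) ?_
      clear * -
      simp only [le_iff_mem, eq_bot_iff_mem, eq_top_iff_mem, mem_bot, mem_top, mem_sup, mem_inf,
        mem_compl, mem_sdiff, ne_eq] at *
      grind
    have hx := x.2
    have hy := y.2
    refine ⟨⟨x.1ᶜ ⊓ y.1ᶜ, h2, ?_⟩, ⟨?_, ?_, h4⟩, ?_, ?_, M.C_comm.1 h5⟩ <;>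
      (try dsimp only) <;> clear h3 h4 h5 <;>
      simp only [le_iff_mem, eq_bot_iff_mem, eq_top_iff_mem, mem_bot, mem_top, mem_sup, mem_inf,
        mem_compl, mem_sdiff, ne_eq] at * <;> grind
  case PON =>
    refine correct_of_consistent_of_not_extensional ?_ M.not_extensional_ECN_PON_ECN (by decide)
      (by decide)
    exact ((correctCell_ECN_PON (M := M) .ECN).1.2 (by decide)).cycle
  case ECN =>
    exact correct_of_consistent_of_not_extensional M.consistent_ECN_ECN_ECN
      (M.not_extensional_ECN_ECN fun _ _ h => h.1) (by decide) (by decide)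
  case NTPP =>
    refine correct_of_not_consistent ?_ (by decide)
    rintro ⟨x, y, z, h1, h2, h3⟩
    refine h1.2.2 (C_mono_right h2.2.2 (inf_compl_eq_bot_iff.1 ?_))
    rw [compl_compl]
    exact h3.1
  case NTPPi =>
    refine correct_of_not_consistent ?_ (by decide)
    rintro ⟨x, y, z, h1, h2, h3⟩
    refine h1.2.2 (C_mono h3.2.2 (inf_compl_eq_bot_iff.1 ?_) le_rfl)
    rw [compl_compl, inf_comm]
    exact h2.1
  all_goals
    refine correct_of_not_consistent ?_ (by decide)
    rintro ⟨x, y, z, h1, h3⟩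
  case PODY | PODZ => exact h2 h1.1 ⟨z, h3⟩
  case ECD => exact h2 h1.2 ⟨z, h3⟩

theorem correctCell_ECN_DC (hM : M.IsStrong) : M.CorrectCell .ECN .DC := by
  intro Q
  have h1 {x y : Region A} (h : x.1 ⊓ y.1ᶜ = ⊥) :
      ¬∃ z : Region A, M.Holds .ECN x.1 z.1 ∧ M.Holds .DC z.1 y.1 :=
    fun ⟨z, h1, h2⟩ => h2.2.2 (C_mono (M.C_comm.1 h1.2.2) le_rfl (inf_compl_eq_bot_iff.1 h))
  have h2 {x y : Region A} (h : x.1ᶜ ⊓ y.1ᶜ = ⊥) :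
      ¬∃ z : Region A, M.Holds .ECN x.1 z.1 ∧ M.Holds .DC z.1 y.1 :=
    fun ⟨z, h1, h2⟩ => not_consistent_of_compl_le h h1.1 h2.1
  cases Q
  case NTPPi =>
    refine correct_of_extensional (fun x y h => ?_) (by decide)
    -- Any `z` that is `ECN` to `x` works, since `y` is away from all of `xᶜ`.
    obtain ⟨z, hz, -⟩ := exists_ECN_left_ECN (inf_compl_self x.1) (M.compl _ x.2.1 x.2.2)
    refine ⟨z, hz, holds_DC.2 fun h' => h.2.2 (C_mono h' (inf_compl_eq_bot_iff.1 ?_) le_rfl)⟩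
    rw [compl_compl, inf_comm]
    exact hz.1
  case DC =>
    refine correct_of_extensional (fun x y h => ?_) (by decide)
    -- The witness is the collar `w \ x` of `x` in a neighbourhood `w` away from `y`.
    obtain ⟨w, h1, h2⟩ := hM.exists_separation (holds_DC.1 h)
    obtain ⟨z, hz, h3⟩ := holds_ECN_chain h1
    exact ⟨z, h3, holds_DC.2 fun h' => h2 (C_mono h' (hz.le.trans sdiff_le) le_rfl)⟩
  case TPPi =>
    exact correct_of_consistent_of_not_extensional
      ((correctCell_ECN_TPPi hM .DC).1.2 (by decide)).cycle M.not_extensional_ECN_TPPi_DC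
      (by decide) (by decide)
  case PON =>
    exact correct_of_consistent_of_not_extensional
      ((correctCell_ECN_PON (M := M) .DC).1.2 (by decide)).cycle M.not_extensional_ECN_PON_DC
      (by decide) (by decide)
  case ECN =>
    exact correct_of_consistent_of_not_extensional
      ((correctCell_ECN_ECN (M := M) .DC).1.2 (by decide)).cycle
      (M.not_extensional_ECN_ECN fun _ _ h => h.1) (by decide) (by decide)
  all_goals
    refine correct_of_not_consistent ?_ (by decide)
    rintro ⟨x, y, z, h3, h4⟩
  case one | TPP | NTPP => exact h1 h3.1 ⟨z, h4⟩
  case PODY | PODZ => exact h2 h3.1 ⟨z, h4⟩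
  case ECD => exact h2 h3.2 ⟨z, h4⟩

/-! ### The whole table -/

theorem correctCell_of_one (R : RCC11) : M.CorrectCell R .one := .conv (correctCell_one _)

theorem correctCell_ECN (hM : M.IsStrong) (S : RCC11) : M.CorrectCell .ECN S := by
  cases S
  case one => exact correctCell_of_one _
  case ECD => exact .right (correctCell_of_one _)
  case ECN => exact correctCell_ECN_ECN
  case TPP => exact .right correctCell_ECN_ECN
  case TPPi => exact correctCell_ECN_TPPi hM
  case PODY => exact .right (correctCell_ECN_TPPi hM)
  case DC => exact correctCell_ECN_DC hM
  case NTPP => exact .right (correctCell_ECN_DC hM)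
  case NTPPi => exact correctCell_ECN_NTPPi hM
  case PODZ => exact .right (correctCell_ECN_NTPPi hM)
  case PON => exact correctCell_ECN_PON

theorem correctCell_DC (hM : M.IsStrong) (S : RCC11) : M.CorrectCell .DC S := by
  have h1 : M.CorrectCell .DC .TPPi := .conv (.mid (correctCell_ECN hM _))
  have h2 : M.CorrectCell .DC .ECN := .conv (correctCell_ECN hM _)
  cases S
  case one => exact correctCell_of_one _
  case ECD => exact .right (correctCell_of_one _)
  case ECN => exact h2
  case TPP => exact .right h2
  case TPPi => exact h1
  case PODY => exact .right h1
  case DC => exact correctCell_DC_DC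
  case NTPP => exact .right correctCell_DC_DC
  case NTPPi => exact correctCell_DC_NTPPi hM
  case PODZ => exact .right (correctCell_DC_NTPPi hM)
  case PON => exact correctCell_DC_PON

theorem correctCell_PON (hM : M.IsStrong) (S : RCC11) : M.CorrectCell .PON S := by
  cases S
  case one => exact correctCell_of_one _
  case ECD => exact .right (correctCell_of_one _)
  case ECN => exact .conv (correctCell_ECN hM _)
  case TPP => exact .right (.conv (correctCell_ECN hM _))
  case TPPi => exact .conv (.mid (correctCell_ECN hM _))
  case PODY => exact .right (.conv (.mid (correctCell_ECN hM _)))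
  case DC => exact .conv (correctCell_DC hM _)
  case NTPP => exact .right (.conv (correctCell_DC hM _))
  case NTPPi => exact .conv (.mid (correctCell_DC hM _))
  case PODZ => exact .right (.conv (.mid (correctCell_DC hM _)))
  case PON => exact correctCell_PON_PON

/-- The first argument is moved to its orbit representative among `1'`, `ECN`, `DC`, `PON` by
complementing `x` and `z`. -/
theorem correctCell (hM : M.IsStrong) (R S : RCC11) : M.CorrectCell R S := by
  cases R
  case one => exact correctCell_one _
  case ECD => exact .left (correctCell_one _)
  case ECN => exact correctCell_ECN hM _
  case TPP => exact .mid (correctCell_ECN hM _)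
  case TPPi => exact .left (correctCell_ECN hM _)
  case PODY => exact .left (.mid (correctCell_ECN hM _))
  case DC => exact correctCell_DC hM _
  case NTPP => exact .mid (correctCell_DC hM _)
  case NTPPi => exact .left (correctCell_DC hM _)
  case PODZ => exact .left (.mid (correctCell_DC hM _))
  case PON => exact correctCell_PON hM _

end RCCModel

/-! ### The regular open sets of a connected `T4` space form a strong RCC model -/

namespace RegularOpen

open TopologicalSpace

variable {X : Type u} [TopologicalSpace X]

/-- The set underlying a regular open set. -/
def carrier (a : Heyting.Regular (Opens X)) : Set X := (a : Opens X)

theorem isOpen_carrier (a : Heyting.Regular (Opens X)) : IsOpen (carrier a) := (a : Opens X).isOpen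

theorem coe_compl (u : Opens X) : ((uᶜ : Opens X) : Set X) = (closure (u : Set X))ᶜ := by
  rw [Opens.coe_compl_eq_interior_compl, interior_compl]

theorem closure_coe_compl_compl (u : Opens X) :
    closure ((uᶜᶜ : Opens X) : Set X) = closure (u : Set X) := by
  refine (closure_minimal ?_ isClosed_closure).antisymm (closure_mono (le_compl_compl (a := u)))
  rw [coe_compl, coe_compl, closure_compl, compl_compl]
  exact interior_subset

theorem carrier_compl (a : Heyting.Regular (Opens X)) :
    carrier aᶜ = (closure (carrier a))ᶜ := coe_compl _

theorem closure_carrier_sup (a b : Heyting.Regular (Opens X)) :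
    closure (carrier (a ⊔ b)) = closure (carrier a) ∪ closure (carrier b) := by
  rw [← closure_union]
  exact closure_coe_compl_compl _

theorem carrier_eq_empty {a : Heyting.Regular (Opens X)} : carrier a = ∅ ↔ a = ⊥ := by
  rw [← Heyting.Regular.coe_inj, Heyting.Regular.coe_bot, ← Opens.coe_inj]
  rfl

theorem carrier_eq_univ {a : Heyting.Regular (Opens X)} : carrier a = Set.univ ↔ a = ⊤ := by
  rw [← Heyting.Regular.coe_inj, Heyting.Regular.coe_top, ← Opens.coe_inj]
  rfl

theorem carrier_nonempty {a : Heyting.Regular (Opens X)} : (carrier a).Nonempty ↔ a ≠ ⊥ := by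
  rw [ne_eq, ← carrier_eq_empty, Set.nonempty_iff_ne_empty]

/-- Every open set `u` has a regular open superset with the same closure. -/
theorem exists_regular {u : Set X} (hu : IsOpen u) :
    ∃ a : Heyting.Regular (Opens X), u ⊆ carrier a ∧ closure (carrier a) = closure u :=
  ⟨Heyting.Regular.toRegular ⟨u, hu⟩, le_compl_compl (a := (⟨u, hu⟩ : Opens X)),
    closure_coe_compl_compl _⟩

theorem ne_top_of_disjoint {a b : Heyting.Regular (Opens X)} (hb : b ≠ ⊥)
    (h : Disjoint (carrier a) (carrier b)) : a ≠ ⊤ := by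
  intro ha
  rw [carrier_eq_univ.2 ha, Set.univ_disjoint, carrier_eq_empty] at h
  exact hb h

variable (X)

/-- The regular open sets, two being in contact when their closures meet. -/
def model [ConnectedSpace X] [Nontrivial X] [T4Space X] :
    RCCModel (Heyting.Regular (Opens X)) where
  C := {p | (closure (carrier p.1) ∩ closure (carrier p.2)).Nonempty}
  exists_ne := by
    obtain ⟨x, y, hxy⟩ := exists_pair_ne X
    obtain ⟨u, v, hu, hv, hxu, hyv, huv⟩ := t2_separation hxy
    obtain ⟨a, ha, ha'⟩ := exists_regular hu
    refine ⟨a, carrier_nonempty.1 ⟨x, ha hxu⟩, fun h => ?_⟩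
    have : y ∈ closure u := by
      rw [← ha', carrier_eq_univ.2 h, closure_univ]
      trivial
    exact Set.disjoint_left.1 (huv.closure_left hv) this hyv
  ne_bot := by
    rintro a b ⟨p, ha, hb⟩
    rw [← carrier_nonempty, ← carrier_nonempty, ← closure_nonempty_iff,
      ← closure_nonempty_iff (s := carrier b)]
    exact ⟨⟨p, ha⟩, ⟨p, hb⟩⟩
  refl a ha := by
    obtain ⟨p, hp⟩ := carrier_nonempty.2 ha
    exact ⟨p, subset_closure hp, subset_closure hp⟩
  symm := by
    rintro a b ⟨p, ha, hb⟩
    exact ⟨p, hb, ha⟩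
  compl a ha haT := by
    -- If the closures of `a` and `aᶜ` were disjoint, `a` would be clopen, against connectedness.
    by_contra h
    rw [Set.mem_ofPred_eq, Set.not_nonempty_iff_eq_empty, ← Set.disjoint_iff_inter_eq_empty] at h
    have hsub : closure (carrier a) ⊆ carrier a := by
      intro p hp
      have := Set.disjoint_left.1 h hp
      rwa [← Set.mem_compl_iff, ← carrier_compl, compl_compl] at this
    have hclopen : IsClopen (carrier a) :=
      ⟨isClosed_of_closure_subset hsub, isOpen_carrier a⟩
    rcases isClopen_iff.1 hclopen with h | h
    · exact ha (carrier_eq_empty.1 h)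
    · exact haT (carrier_eq_univ.1 h)
  sup a b c _ _ _ := by
    simp only [Set.mem_ofPred_eq, closure_carrier_sup, Set.inter_union_distrib_left,
      Set.union_nonempty]
  exists_not a ha haT := by
    obtain ⟨p, hp⟩ := carrier_nonempty.2 (show aᶜ ≠ ⊥ by simpa using haT)
    obtain ⟨v, hv, hpv, hvs⟩ := normal_exists_closure_subset isClosed_singleton
      (isOpen_carrier aᶜ) (Set.singleton_subset_iff.2 hp)
    obtain ⟨w, hw, hw'⟩ := exists_regular hv
    have hdisj : Disjoint (closure (carrier a)) (closure (carrier w)) := by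
      rw [hw', Set.disjoint_right]
      intro q hq
      rw [← Set.mem_compl_iff, ← carrier_compl]
      exact hvs hq
    refine ⟨w, carrier_nonempty.1 ⟨p, hw (hpv rfl)⟩, ?_, ?_⟩
    · exact ne_top_of_disjoint ha (hdisj.mono subset_closure subset_closure).symm
    · rintro ⟨q, hq, hq'⟩
      exact Set.disjoint_left.1 hdisj hq hq'

/-- Interpolation is normality: insert an open set and its closure between the closure of `x` and
the complement of the closure of `yᶜ`. -/
theorem isStrong_model [ConnectedSpace X] [Nontrivial X] [T4Space X] : (model X).IsStrong := by
  intro x y hxy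
  rw [RCCModel.mem_NTPP] at hxy
  have hsub : closure (carrier x.1) ⊆ (closure (carrier y.1ᶜ))ᶜ :=
    fun p hp hp' => hxy ⟨p, hp, hp'⟩
  obtain ⟨v, hv, hxv, hvs⟩ := normal_exists_closure_subset isClosed_closure
    isClosed_closure.isOpen_compl hsub
  obtain ⟨z, hz, hz'⟩ := exists_regular hv
  obtain ⟨p, hp⟩ := carrier_nonempty.2 x.2.1
  refine ⟨⟨z, carrier_nonempty.1 ⟨p, hz (hxv (subset_closure hp))⟩, ?_⟩, ?_, ?_⟩
  · refine ne_top_of_disjoint (RCCModel.compl_region y).1 (Set.disjoint_left.2 fun q hq hq' => ?_)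
    exact hvs (hz' ▸ subset_closure hq) (subset_closure hq')
  · rw [RCCModel.mem_NTPP]
    rintro ⟨q, hq, hq'⟩
    rw [carrier_compl, closure_compl] at hq'
    exact hq' (interior_mono subset_closure (by
      rw [(isOpen_carrier z).interior_eq]
      exact hz (hxv hq)))
  · rw [RCCModel.mem_NTPP]
    rintro ⟨q, hq, hq'⟩
    rw [hz'] at hq
    exact hvs hq hq'

end RegularOpen

/-! ### Existence of a strong model and conclusion -/

theorem exists_strong_model :
    ∃ (A : Type u) (_ : BooleanAlgebra A) (M : RCCModel A), M.IsStrong := by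
  have : ConnectedSpace (ULift.{u} ℝ) := Homeomorph.ulift.symm.surjective.connectedSpace
    Homeomorph.ulift.symm.continuous
  exact ⟨_, _, _, RegularOpen.isStrong_model (ULift.{u} ℝ)⟩

theorem mainTheorem5 (R T S : RCC11) :
    (∀ (A : Type u) [BooleanAlgebra A] (M : RCCModel A), M.IsStrong →
      ((M.rel T ∩ (M.rel R ○ M.rel S)).Nonempty ↔ RCC11.IsTriad R T S) ∧
      (M.rel T ⊆ M.rel R ○ M.rel S ↔ RCC11.IsPlain R T S)) ∧
    ((∀ (A : Type u) [BooleanAlgebra A] (M : RCCModel A), M.IsStrong →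
      M.rel T ⊆ M.rel R ○ M.rel S) ↔ RCC11.IsPlain R T S) := by
  have main (A : Type u) [BooleanAlgebra A] (M : RCCModel A) (hM : M.IsStrong) :
      ((M.rel T ∩ (M.rel R ○ M.rel S)).Nonempty ↔ RCC11.IsTriad R T S) ∧
      (M.rel T ⊆ M.rel R ○ M.rel S ↔ RCC11.IsPlain R T S) := by
    rw [← RCCModel.consistent_iff, ← RCCModel.extensional_iff]
    exact RCCModel.correctCell hM R S T
  refine ⟨main, fun h => ?_, fun h A _ M hM => (main A M hM).2.2 h⟩
  -- Without a strong model the universal inclusion would be vacuous; a single one suffices, as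
  -- inclusion in it already decides the mark.
  obtain ⟨A, _, M, hM⟩ := exists_strong_model.{u}
  exact (main A M hM).2.1 (h A M hM)
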